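/- **Setting.** Let $U=[0,1]\times[0,1]$ and consider the functional deconvolution model $$y(u,t)=\int_0^1 g(u,t-x)f(u,x)\,dx+\varepsilon z(u,t),\qquad u,t\in[0,1],$$ where $f\in L^2(U)$ is an unknown real function, $g$ is a known real measurable kernel, $1$-periodic in its second variable with $g(u,\cdot)\in L^1([0,1])$ for every $u\in[0,1]$, $\varepsilon>0$, and $z$ is a two-dimensional Gaussian white noise, i.e. one observes $y(v)=\langle g*f,v\rangle_{L^2(U)}+\varepsilon z(v)$ for $v\in L^2(U)$, where $(g*f)(u,t)=\int_0^1 g(u,t-x)f(u,x)\,dx$ and $(z(v))_{v\in L^2(U)}$ is a centered Gaussian family with $\mathbf E[z(v)z(w)]=\langle v,w\rangle_{L^2(U)}$. *Kernel.* With $e_m(t)=e^{2\pi i m t}$ and $g_m(u)=\langle e_m,g(u,\cdot)\rangle=\int_0^1 e_m(t)\overline{g(u,t)}\,dt$, assume that for some $\nu,C_1,C_2>0$ $$C_1|m|^{-2\nu}\le |g_m(u)|^2\le C_2|m|^{-2\nu}\qquad\text{for all } m\in\mathbb Z\setminus\{0\},\ u\in[0,1],$$ and that $g_0$ is bounded on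 $[0,1]$. *Wavelets.* For $w:\mathbb R\to\mathbb R$ write $w_{j,k}(x)=\sum_{l\in\mathbb Z}2^{j/2}w(2^j(x+l)-k)$. Let $m_0,m_0'\ge 0$ be integers. Let $\{\psi_{j,k}\}$ be a bounded-bandwidth (Meyer-type) periodized wavelet basis with lowest resolution level $m_0$: there are integrable functions $\varphi,\psi$ on $\mathbb R$ whose Fourier transforms have compact support, that of $\psi$ vanishing in a neighbourhood of $0$, such that the functions $\psi_{m_0-1,k}:=\varphi_{m_0,k}$ ($0\le k<2^{m_0}$) and $\psi_{j,k}$ ($j\ge m_0$, $0\le k<2^j$) form an orthonormal basis of $L^2([0,1])$. Let $\{\eta_{j',k'}\}$ be a finitely supported (Daubechies-type) periodized wavelet basis with lowest level $m_0'$: it is generated in the same way by compactly supported functions $\chi$ (scaling function) and $\eta$ (wavelet) in $L^2(\mathbb R)$. Put $$\beta_{j,k,j',k'}=\iint_U f(u,x)\,\psi_{j,k}(x)\,\eta_{j',k'}(u)\,du\,dx .$$ *Smoothness class and risk.* For $s_1,s_2\in\mathbb R$, $1\le p,q\le\infty$ and $A>0$ let $s_i^*=s_i+\frac12-\frac1p$,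 $s_1'=s_1+\frac12-\frac1{\min\{p,2\}}$ and $$B^{s_1,s_2}_{p,q}(A)=\Big\{f\in L^2(U):\ \Big(\sum_{j\ge m_0-1,\;j'\ge m_0'-1}2^{(js_1^*+j's_2^*)q}\Big(\sum_{k,k'}|\beta_{j,k,j',k'}|^p\Big)^{q/p}\Big)^{1/q}\le A\Big\}$$ (with suprema in place of sums when $p=\infty$ or $q=\infty$). For $V\subseteq L^2(U)$ let $R_\varepsilon(V)=\inf_{\tilde f}\sup_{f\in V}\mathbf E\|\tilde f-f\|^2_{L^2(U)}$, the infimum being over all measurable functions $\tilde f$ of the observation $y$ with values in $L^2(U)$. **Theorem.** Let $1\le p,q\le\infty$ and $\min\{s_1,s_2\}\ge\max\{1/p,1/2\}$, and let $\nu,C_1,C_2>0$. There is a constant $C>0$, which may depend on $p,q,s_1,s_2,\nu,C_1,C_2$ and the two wavelet bases but not on $\varepsilon$, $A$ or $g$, such that for every kernel $g$ as above and every $A>0$, for all sufficiently small $\varepsilon>0$, $$R_\varepsilon\big(B^{s_1,s_2}_{p,q}(A)\big)\ \ge\ C A^2\Big(\frac{\varepsilon^2}{A^2}\Big)^d,\qquad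 d=\min\Big(\frac{2s_2}{2s_2+1},\ \frac{2s_1}{2s_1+2\nu+1},\ \frac{2s_1'}{2s_1'+2\nu}\Big).$$ -/

import Mathlib

open MeasureTheory ProbabilityTheory Filter Topology
open scoped ENNReal FourierTransform ComplexConjugate

noncomputable section

namespace FunctionalDeconvolution

/-- Lebesgue measure on `[0,1]`. -/
abbrev unitMeasure : Measure ℝ := volume.restrict (Set.Icc 0 1)

/-- Lebesgue measure on the unit square `U = [0,1] × [0,1]`; points are written `(u, x)`. -/
abbrev squareMeasure : Measure (ℝ × ℝ) := unitMeasure.prod unitMeasure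

/-- The real Hilbert space `L²(U)`. -/
abbrev L2U : Type := Lp ℝ 2 squareMeasure

/-! ### Periodized wavelet bases -/

/-- The periodization `∑_{l ∈ ℤ} 2^{j/2} w(2^j (x + l) - k)` of the dilated and translated
function `w`. -/
def periodized (w : ℝ → ℝ) (j k : ℕ) (x : ℝ) : ℝ :=
  ∑' l : ℤ, (2 : ℝ) ^ ((j : ℝ) / 2) * w (2 ^ j * (x + l) - k)

/-- The number of basis functions in the `n`-th block: the block `n = 0` holds the
scaling functions of the lowest resolution level `m₀`, the block `n + 1` holds the wavelets of
level `m₀ + n`. -/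
def blockCard (m₀ : ℕ) : ℕ → ℕ
  | 0 => 2 ^ m₀
  | n + 1 => 2 ^ (m₀ + n)

/-- The level attached to the `n`-th block: `m₀ - 1` for the scaling functions, and then
`m₀, m₀ + 1, …` for the wavelets. -/
def blockLevel (m₀ n : ℕ) : ℝ := (m₀ : ℝ) + n - 1

/-- The periodized wavelet system with scaling function `φ`, wavelet `ψ` and lowest
resolution level `m₀`. -/
def waveletFun (m₀ : ℕ) (φ ψ : ℝ → ℝ) : (n : ℕ) → Fin (blockCard m₀ n) → ℝ → ℝ
  | 0, k => periodized φ m₀ k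
  | n + 1, k => periodized ψ (m₀ + n) k

/-- The periodized system generated by `φ` and `ψ` is an orthonormal basis of `L²([0,1])`. -/
def IsPeriodizedWaveletBasis (m₀ : ℕ) (φ ψ : ℝ → ℝ) : Prop :=
  ∃ b : HilbertBasis (Σ n : ℕ, Fin (blockCard m₀ n)) ℝ (Lp ℝ 2 unitMeasure),
    ∀ i, (b i : ℝ → ℝ) =ᵐ[unitMeasure] waveletFun m₀ φ ψ i.1 i.2

/-- A bounded-bandwidth (Meyer-type) periodized wavelet basis: `φ` and `ψ` have compactly
supported Fourier transforms, that of `ψ` vanishing near the origin. -/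
structure IsBandLimitedWaveletBasis (m₀ : ℕ) (φ ψ : ℝ → ℝ) : Prop where
  integrable_scaling : Integrable φ
  integrable_wavelet : Integrable ψ
  band : ∃ a b : ℝ, 0 < a ∧ a < b ∧
    (∀ ξ : ℝ, b < |ξ| → 𝓕 (fun x : ℝ => (φ x : ℂ)) ξ = 0) ∧
    (∀ ξ : ℝ, |ξ| < a ∨ b < |ξ| → 𝓕 (fun x : ℝ => (ψ x : ℂ)) ξ = 0)
  basis : IsPeriodizedWaveletBasis m₀ φ ψ

/-- A finitely supported (Daubechies-type) periodized wavelet basis. -/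
structure IsFinitelySupportedWaveletBasis (m₀ : ℕ) (φ ψ : ℝ → ℝ) : Prop where
  memLp_scaling : MemLp φ 2
  memLp_wavelet : MemLp ψ 2
  compact_scaling : HasCompactSupport φ
  compact_wavelet : HasCompactSupport ψ
  basis : IsPeriodizedWaveletBasis m₀ φ ψ

/-! ### Besov balls of mixed smoothness -/

/-- The `ℓ^r` norm of a nonnegative family, with the supremum for `r = ∞`. -/
def ellNorm {ι : Type*} (r : ℝ≥0∞) (a : ι → ℝ≥0∞) : ℝ≥0∞ :=
  if r = ∞ then ⨆ i, a i else (∑' i, a i ^ r.toReal) ^ (1 / r.toReal)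

/-- The number `1/p`, equal to `0` for `p = ∞`. -/
def recip (p : ℝ≥0∞) : ℝ := (p⁻¹).toReal

/-- The coefficient `∬ f(u,x) ψ_{j,k}(x) η_{j',k'}(u) du dx`; here `φ, ψ, m₀` generate the basis
in the variable `x` and `χ, η, m₀'` the basis in the variable `u`. -/
def coeff (m₀ : ℕ) (φ ψ : ℝ → ℝ) (m₀' : ℕ) (χ η : ℝ → ℝ) (f : L2U)
    (n n' : ℕ) (k : Fin (blockCard m₀ n)) (k' : Fin (blockCard m₀' n')) : ℝ :=
  ∫ z, f z * (waveletFun m₀ φ ψ n k z.2 * waveletFun m₀' χ η n' k' z.1) ∂squareMeasure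

/-- The norm
`(∑_{j,j'} 2^{(j s₁* + j' s₂*) q} (∑_{k,k'} |β_{j,k,j',k'}|^p)^{q/p})^{1/q}`
with `sᵢ* = sᵢ + 1/2 - 1/p`. -/
def besovNorm (m₀ : ℕ) (φ ψ : ℝ → ℝ) (m₀' : ℕ) (χ η : ℝ → ℝ) (s₁ s₂ : ℝ) (p q : ℝ≥0∞)
    (f : L2U) : ℝ≥0∞ :=
  ellNorm q fun n : ℕ × ℕ =>
    ENNReal.ofReal ((2 : ℝ) ^ (blockLevel m₀ n.1 * (s₁ + 1 / 2 - recip p)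
        + blockLevel m₀' n.2 * (s₂ + 1 / 2 - recip p))) *
      ellNorm p fun k : Fin (blockCard m₀ n.1) × Fin (blockCard m₀' n.2) =>
        ENNReal.ofReal |coeff m₀ φ ψ m₀' χ η f n.1 n.2 k.1 k.2|

/-- The Besov ball `B^{s₁,s₂}_{p,q}(A)`. -/
def besovBall (m₀ : ℕ) (φ ψ : ℝ → ℝ) (m₀' : ℕ) (χ η : ℝ → ℝ) (s₁ s₂ : ℝ) (p q : ℝ≥0∞)
    (A : ℝ) : Set L2U :=
  {f | besovNorm m₀ φ ψ m₀' χ η s₁ s₂ p q f ≤ ENNReal.ofReal A}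

/-! ### The observation model -/

/-- The functional Fourier coefficient `g_m(u) = ⟨e_m, g(u,·)⟩ = ∫_0^1 e^{2πimt} conj(g(u,t)) dt`
of a real kernel. -/
def kernelCoeff (g : ℝ → ℝ → ℝ) (m : ℤ) (u : ℝ) : ℂ :=
  ∫ t, Complex.exp (2 * Real.pi * Complex.I * m * t) * conj (g u t : ℂ) ∂unitMeasure

/-- The convolution kernels with `C₁ |m|^{-2ν} ≤ |g_m(u)|² ≤ C₂ |m|^{-2ν}` for `m ≠ 0`. The
coefficient `g_0` is only required to be bounded, so that convolution with `g` acts on `L²(U)`. -/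
structure IsConvolutionKernel (ν C₁ C₂ : ℝ) (g : ℝ → ℝ → ℝ) : Prop where
  measurable : Measurable (Function.uncurry g)
  periodic : ∀ u, Function.Periodic (g u) 1
  integrable : ∀ u ∈ Set.Icc (0 : ℝ) 1, Integrable (g u) unitMeasure
  bounded_zero : ∃ C₀ : ℝ, ∀ u ∈ Set.Icc (0 : ℝ) 1, ‖kernelCoeff g 0 u‖ ≤ C₀
  lower : ∀ m : ℤ, m ≠ 0 → ∀ u ∈ Set.Icc (0 : ℝ) 1,
    C₁ * |(m : ℝ)| ^ (-2 * ν) ≤ ‖kernelCoeff g m u‖ ^ 2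
  upper : ∀ m : ℤ, m ≠ 0 → ∀ u ∈ Set.Icc (0 : ℝ) 1,
    ‖kernelCoeff g m u‖ ^ 2 ≤ C₂ * |(m : ℝ)| ^ (-2 * ν)

/-- The convolution `h(u,t) = ∫_0^1 g(u, t - x) f(u, x) dx`. -/
def convolved (g : ℝ → ℝ → ℝ) (f : L2U) (w : ℝ × ℝ) : ℝ :=
  ∫ x, g w.1 (w.2 - x) * f (w.1, x) ∂unitMeasure

/-- Gaussian white noise on `U`: a centered Gaussian family `z(v)`, `v ∈ L²(U)`, with
`E[z(v) z(w)] = ⟨v, w⟩`, i.e. with covariance `δ(u₁ - u₂) δ(t₁ - t₂)`. -/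
structure IsWhiteNoise {Ω : Type*} [MeasurableSpace Ω] (P : Measure Ω) (z : L2U → Ω → ℝ) :
    Prop where
  measurable : ∀ v, Measurable (z v)
  gaussian : IsGaussianProcess z P
  mean : ∀ v, ∫ ω, z v ω ∂P = 0
  covariance : ∀ v w, ∫ ω, z v ω * z w ω ∂P = inner ℝ v w

/-- The observation `y = g * f + ε z`, tested against `v ∈ L²(U)`:
`y(v) = ⟨g * f, v⟩ + ε z(v)`. -/
def observation {Ω : Type*} (g : ℝ → ℝ → ℝ) (ε : ℝ) (z : L2U → Ω → ℝ) (f : L2U) (ω : Ω) :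
    L2U → ℝ :=
  fun v => (∫ w, convolved g f w * v w ∂squareMeasure) + ε * z v ω

/-- The minimax `L²`-risk `inf_T sup_{f ∈ V} E ‖T(y) - f‖²`, with the infimum over all measurable
functions `T` of the observation with values in `L²(U)`. -/
def minimaxRisk {Ω : Type*} [MeasurableSpace Ω] (P : Measure Ω) (z : L2U → Ω → ℝ)
    (g : ℝ → ℝ → ℝ) (ε : ℝ) (V : Set L2U) : ℝ≥0∞ :=
  ⨅ (T : (L2U → ℝ) → L2U) (_ : @Measurable (L2U → ℝ) L2U MeasurableSpace.pi (borel L2U) T),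
    ⨆ f ∈ V, ∫⁻ ω, ‖T (observation g ε z f ω) - f‖ₑ ^ 2 ∂P

/-- The exponent
`d = min (2s₂/(2s₂+1), 2s₁/(2s₁+2ν+1), 2s₁'/(2s₁'+2ν))` with `s₁' = s₁ + 1/2 - 1/min(p,2)`. -/
def rateExponent (s₁ s₂ ν : ℝ) (p : ℝ≥0∞) : ℝ :=
  let s₁' := s₁ + 1 / 2 - recip (min p 2)
  min (min (2 * s₂ / (2 * s₂ + 1)) (2 * s₁ / (2 * s₁ + 2 * ν + 1)))
    (2 * s₁' / (2 * s₁' + 2 * ν))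

end FunctionalDeconvolution

end

open MeasureTheory ProbabilityTheory Filter Topology
open scoped ENNReal FourierTransform ComplexConjugate

noncomputable section

namespace FunctionalDeconvolution

/-! ### Overlap of shifted Gaussian experiments -/

/-! The bound comes from Assouad's method on finite hypercubes inside the Besov ball. A hypercube is
spanned by products of one wavelet in `x` and one basis function in `u`, all from a single block of
coefficients, with side `γ`. Its vertices have an explicitly bounded Besov norm, and flipping one
bit changes the mean of the data by `±γ` times the convolved basis function. If that change has norm
at most `ε`, the two laws of the data share a fixed mass (`exists_common_minorant`), so no estimator
can determine the bit. Averaging over the vertices gives a risk of at least a constant times `N γ²`,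
where `N` is the dimension (`hypercube_lower_bound`). The ill-posedness enters through the band
limitation in `x`: a wavelet of level `j` is a trigonometric polynomial with frequencies at least a
constant times `2^j`. Each `e_m` is an eigenfunction of the convolution at fixed `u`, so Parseval
and the upper bound on `|g_m(u)|²` show that convolution multiplies the squared norm by at most a
constant times `2^(-2jν)`, uniformly in `u`. The constants involve `C₂` but not the kernel itself.
Three hypercubes produce the three exponents: a full block in `u` at a fixed level in `x`, a full
block in `x` for one function of `u`, and a single coefficient. In each case `exists_level` takes
the largest `γ` that the ball allows and then the lowest level, up to a factor `2`, that meets the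
noise constraint. Since `d` is a minimum, it suffices to use the hypercube whose exponent attains
it. -/

/-- The value at `1` of the standard Gaussian density; two Gaussian shifts at distance at most one
standard deviation share at least this mass. -/
def overlap : ℝ := gaussianPDFReal 0 1 1

lemma overlap_pos : 0 < overlap := gaussianPDFReal_pos _ _ _ one_ne_zero

lemma overlap_le_one : overlap ≤ 1 := by
  have h1 : (1 : ℝ) ≤ √(2 * Real.pi) := by
    rw [Real.one_le_sqrt]
    nlinarith [Real.pi_gt_three]
  have h2 : Real.exp (-(1 - 0) ^ 2 / (2 * 1)) ≤ 1 := by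
    rw [Real.exp_le_one_iff]
    norm_num
  simp only [overlap, gaussianPDFReal, NNReal.coe_one, mul_one] at h2 ⊢
  exact mul_le_one₀ (inv_le_one_of_one_le₀ h1) (Real.exp_nonneg _) h2

/-- A multiple of Lebesgue measure on `[0,1]` lies below every unit-variance Gaussian law whose
mean is in `[0,1]`. -/
lemma smul_unitMeasure_le_gaussianReal {r : ℝ} (hr : r ∈ Set.Icc (0 : ℝ) 1) :
    ENNReal.ofReal overlap • unitMeasure ≤ gaussianReal r 1 := by
  rw [gaussianReal_of_var_ne_zero _ one_ne_zero, ← withDensity_const]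
  refine Measure.le_intro fun s hs _ => ?_
  rw [withDensity_apply _ hs, withDensity_apply _ hs, Measure.restrict_restrict hs,
    ← lintegral_indicator (hs.inter measurableSet_Icc), ← lintegral_indicator hs]
  refine lintegral_mono fun x => ?_
  by_cases hx : x ∈ s ∩ Set.Icc 0 1
  · rw [Set.indicator_of_mem hx, Set.indicator_of_mem hx.1]
    refine ENNReal.ofReal_le_ofReal ?_
    simp only [overlap, gaussianPDFReal, NNReal.coe_one]
    obtain ⟨hx0, hx1⟩ := hx.2
    obtain ⟨hr0, hr1⟩ := hr
    -- Points of `[0,1]` are at most one standard deviation apart, so the density with mean `r` is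
    -- at least `overlap` at `x`.
    have hsq : (x - r) ^ 2 ≤ (1 - 0) ^ 2 := sq_le_sq' (by linarith) (by linarith)
    gcongr
  · rw [Set.indicator_of_notMem hx]
    exact zero_le

namespace IsWhiteNoise

variable {Ω : Type*} [MeasurableSpace Ω] {P : Measure Ω} {z : L2U → Ω → ℝ}

lemma covariance_eq (hz : IsWhiteNoise P z) (v w : L2U) : cov[z v, z w; P] = inner ℝ v w := by
  have := hz.gaussian.isProbabilityMeasure
  rw [covariance_eq_sub (hz.gaussian.hasGaussianLaw_eval v).memLp_two
    (hz.gaussian.hasGaussianLaw_eval w).memLp_two, hz.mean, hz.mean]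
  simpa using hz.covariance v w

lemma map_eq_gaussianReal (hz : IsWhiteNoise P z) {e : L2U} (he : ‖e‖ = 1) :
    P.map (z e) = gaussianReal 0 1 := by
  have := hz.gaussian.isProbabilityMeasure
  rw [(hz.gaussian.hasGaussianLaw_eval e).map_eq_gaussianReal, hz.mean,
    ← covariance_self (hz.measurable e).aemeasurable, hz.covariance_eq,
    real_inner_self_eq_norm_sq, he]
  simp

/-- The value of white noise at a unit vector is independent of its orthogonal part. -/
lemma indepFun_orthogonal (hz : IsWhiteNoise P z) {e : L2U} (he : ‖e‖ = 1) :
    IndepFun (z e) (fun ω v => z v ω - inner ℝ e v * z e ω) P := by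
  classical
  have hprob := hz.gaussian.isProbabilityMeasure
  have hmem : ∀ v, MemLp (z v) 2 P := fun v => (hz.gaussian.hasGaussianLaw_eval v).memLp_two
  let X : Unit → Ω → ℝ := fun _ => z e
  let Y : L2U → Ω → ℝ := fun v ω => z v ω - inner ℝ e v * z e ω
  -- Every coordinate is a linear combination of finitely many values of `z`, so the family is
  -- jointly Gaussian and vanishing covariance gives independence.
  have hXY : IsGaussianProcess (Sum.elim X Y) P := by
    refine hz.gaussian.of_isGaussianProcess fun s => ?_
    rcases s with s | v
    · refine ⟨{e}, ContinuousLinearMap.proj ⟨e, Finset.mem_singleton_self e⟩, fun ω => ?_⟩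
      simp [X, Finset.restrict_def]
    · refine ⟨{v, e}, ContinuousLinearMap.proj ⟨v, by simp⟩
        - (inner ℝ e v : ℝ) • ContinuousLinearMap.proj ⟨e, by simp⟩, fun ω => ?_⟩
      simp [Y, Finset.restrict_def]
  have hind : IndepFun (fun ω s => X s ω) (fun ω v => Y v ω) P := by
    refine hXY.indepFun_of_covariance_eq_zero (fun _ => (hz.measurable e).aemeasurable)
      (fun v => ((hz.measurable v).sub ((hz.measurable e).const_mul _)).aemeasurable)
      fun _ v => ?_
    have hY : Y v = z v - fun ω => inner ℝ e v * z e ω := rfl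
    rw [hY, covariance_sub_right (hmem e) (hmem v) ((hmem e).const_mul _),
      covariance_const_mul_right, hz.covariance_eq, hz.covariance_eq,
      real_inner_self_eq_norm_sq, he]
    simp
  exact hind.comp (measurable_pi_apply ()) measurable_id

/-- The laws of two observations whose means differ by at most the noise level have a common part
of mass at least `overlap`. -/
lemma exists_common_minorant (hz : IsWhiteNoise P z) {ε : ℝ} (hε : 0 < ε) (μ₁ μ₂ : L2U → ℝ)
    (δ : L2U) (hδ : ∀ v, μ₂ v = μ₁ v + inner ℝ δ v) (hδε : ‖δ‖ ≤ ε) :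
    ∃ Λ : Measure (L2U → ℝ), Λ ≤ P.map (fun ω v => μ₁ v + ε * z v ω) ∧
      Λ ≤ P.map (fun ω v => μ₂ v + ε * z v ω) ∧ ENNReal.ofReal overlap ≤ Λ Set.univ := by
  have hprob := hz.gaussian.isProbabilityMeasure
  -- A zero shift has no direction to normalise, but then the two laws coincide.
  rcases eq_or_ne δ 0 with rfl | hne
  · have hμ : μ₂ = μ₁ := funext fun v => by simpa using hδ v
    subst hμ
    refine ⟨_, le_rfl, le_rfl, ?_⟩
    rw [Measure.map_apply (measurable_pi_lambda _ fun v => by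
      exact ((hz.measurable v).const_mul ε).const_add _) MeasurableSet.univ]
    simpa using overlap_le_one
  have hδ0 : 0 < ‖δ‖ := norm_pos_iff.2 hne
  set e : L2U := ‖δ‖⁻¹ • δ with he_def
  have he : ‖e‖ = 1 := by
    rw [he_def, norm_smul, norm_inv, norm_norm, inv_mul_cancel₀ hδ0.ne']
  have hinner : ∀ v, inner ℝ δ v = ‖δ‖ * inner ℝ e v := fun v => by
    rw [he_def, real_inner_smul_left, mul_inv_cancel_left₀ hδ0.ne']
  let W : Ω → L2U → ℝ := fun ω v => z v ω - inner ℝ e v * z e ω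
  have hW : Measurable W := measurable_pi_lambda _ fun v =>
    (hz.measurable v).sub ((hz.measurable e).const_mul _)
  -- `Φ` rebuilds the data from the noise along `e` and the independent orthogonal noise. Replacing
  -- `z e` by `z e + ‖δ‖/ε` turns the mean `μ₁` into `μ₂`, which reduces the comparison to one real
  -- Gaussian variable.
  let Φ : ℝ × (L2U → ℝ) → L2U → ℝ := fun y v => μ₁ v + ε * (inner ℝ e v * y.1 + y.2 v)
  have hΦ : Measurable Φ := measurable_pi_lambda _ fun v => by
    have : Measurable fun y : ℝ × (L2U → ℝ) => y.2 v :=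
      (measurable_pi_apply v).comp measurable_snd
    fun_prop
  have hprobW : IsProbabilityMeasure (P.map W) := Measure.isProbabilityMeasure_map hW.aemeasurable
  have hjoint : P.map (fun ω => (z e ω, W ω)) = (gaussianReal 0 1).prod (P.map W) := by
    rw [← hz.map_eq_gaussianReal he]
    exact (indepFun_iff_map_prod_eq_prod_map_map (hz.measurable e).aemeasurable
      hW.aemeasurable).1 (hz.indepFun_orthogonal he)
  have hlaw : ∀ r : ℝ, P.map (fun ω v => Φ (z e ω + r, W ω) v)
      = ((gaussianReal r 1).prod (P.map W)).map Φ := by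
    intro r
    have h1 : (gaussianReal r 1).prod (P.map W)
        = ((gaussianReal 0 1).prod (P.map W)).map (Prod.map (· + r) id) := by
      rw [← Measure.map_prod_map _ _ (measurable_add_const r) measurable_id, Measure.map_id,
        gaussianReal_map_add_const, zero_add]
    rw [h1, ← hjoint, Measure.map_map ((measurable_add_const r).prodMap measurable_id)
      ((hz.measurable e).prodMk hW), Measure.map_map hΦ (((measurable_add_const r).prodMap
      measurable_id).comp ((hz.measurable e).prodMk hW))]
    rfl
  -- The left side does not depend on `r`; the values `r = 0` and `r = ‖δ‖/ε ≤ 1` give the two laws.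
  have key : ∀ r ∈ Set.Icc (0 : ℝ) 1,
      ((ENNReal.ofReal overlap • unitMeasure).prod (P.map W)).map Φ
        ≤ P.map (fun ω v => Φ (z e ω + r, W ω) v) := by
    intro r hr
    rw [hlaw r]
    exact Measure.map_mono (Measure.prod_mono (smul_unitMeasure_le_gaussianReal hr) le_rfl) hΦ
  refine ⟨((ENNReal.ofReal overlap • unitMeasure).prod (P.map W)).map Φ, ?_, ?_, ?_⟩
  · convert key 0 ⟨le_rfl, zero_le_one⟩ using 3 with ω v
    funext v
    simp only [Φ, W]
    ring
  · convert key (‖δ‖ / ε) ⟨by positivity, (div_le_one hε).2 hδε⟩ using 3 with ω v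
    funext v
    simp only [Φ, W, hδ v, hinner v]
    field_simp
    ring
  · rw [Measure.map_apply hΦ MeasurableSet.univ, Set.preimage_univ, Measure.prod_apply
      MeasurableSet.univ]
    simp

end IsWhiteNoise

/-! ### Lower bound over a hypercube -/

section Hypercube

variable {ι : Type*}

/-- Flipping the `i`-th coordinate of a binary vector. -/
def flipBit [DecidableEq ι] (i : ι) : Equiv.Perm (ι → Bool) :=
  Function.Involutive.toPerm (fun θ => Function.update θ i (!θ i)) fun θ => by simp

lemma flipBit_apply_self [DecidableEq ι] (i : ι) (θ : ι → Bool) : flipBit i θ i = !θ i := by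
  simp [flipBit, Function.Involutive.toPerm]

variable [Fintype ι]

/-- The vertex `∑ i, γ θ i • e i`, `θ ∈ {0,1}^ι`, of a hypercube with side length `γ`. -/
def hypercubeVertex (e : ι → L2U) (γ : ℝ) (θ : ι → Bool) : L2U :=
  ∑ i, (if θ i then γ else 0) • e i

/-- No orthogonality is needed here, so the formula also applies to the convolved family `H`. -/
lemma hypercubeVertex_flipBit [DecidableEq ι] (e : ι → L2U) (γ : ℝ) (θ : ι → Bool) (i : ι) :
    hypercubeVertex e γ (flipBit i θ)
      = hypercubeVertex e γ θ + (if θ i then -γ else γ) • e i := by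
  unfold hypercubeVertex
  rw [← Finset.add_sum_erase _ _ (Finset.mem_univ i),
    ← Finset.add_sum_erase _ (fun j => (if θ j then γ else 0) • e j) (Finset.mem_univ i),
    flipBit_apply_self]
  have h : ∀ j ∈ Finset.univ.erase i, (if flipBit i θ j then γ else 0) • e j
      = (if θ j then γ else 0) • e j := fun j hj => by
    rw [show flipBit i θ j = θ j from Function.update_of_ne (Finset.ne_of_mem_erase hj) _ _]
  rw [Finset.sum_congr rfl h]
  cases θ i <;> simp [add_comm]

lemma inner_hypercubeVertex {e : ι → L2U} (he : Orthonormal ℝ e) (γ : ℝ) (θ : ι → Bool) (i : ι) :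
    inner ℝ (e i) (hypercubeVertex e γ θ) = if θ i then γ else 0 :=
  he.inner_right_fintype _ i

/-- **Assouad's lemma** for the Gaussian white noise model. -/
lemma IsWhiteNoise.hypercube_lower_bound {Ω : Type*} [MeasurableSpace Ω] {P : Measure Ω}
    {z : L2U → Ω → ℝ} (hz : IsWhiteNoise P z) {ε : ℝ} (hε : 0 < ε)
    {e : ι → L2U} (he : Orthonormal ℝ e) (H : ι → L2U) {γ : ℝ} (hγ : ∀ i, ‖γ • H i‖ ≤ ε)
    (T : (L2U → ℝ) → L2U)
    (hT : @Measurable (L2U → ℝ) L2U MeasurableSpace.pi (borel L2U) T) :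
    ∃ θ : ι → Bool, ENNReal.ofReal (overlap / 4 * Fintype.card ι * γ ^ 2) ≤
      ∫⁻ ω, ‖T (fun v => inner ℝ (hypercubeVertex H γ θ) v + ε * z v ω)
        - hypercubeVertex e γ θ‖ₑ ^ 2 ∂P := by
  classical
  let _ : MeasurableSpace L2U := borel L2U
  have : BorelSpace L2U := ⟨rfl⟩
  let Y : (ι → Bool) → Ω → L2U → ℝ := fun θ ω v => inner ℝ (hypercubeVertex H γ θ) v + ε * z v ω
  have hY : ∀ θ, Measurable (Y θ) := fun θ => measurable_pi_lambda _ fun v => by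
    exact ((hz.measurable v).const_mul ε).const_add _
  let loss : ι → ℝ → (L2U → ℝ) → ℝ≥0∞ := fun i c y => ENNReal.ofReal ((inner ℝ (e i) (T y) - c) ^ 2)
  have hloss : ∀ i c, Measurable (loss i c) := fun i c => by
    have h1 : Measurable fun y => inner ℝ (e i) (T y) :=
      (Continuous.measurable (by fun_prop : Continuous fun x : L2U => inner ℝ (e i) x)).comp hT
    exact ((h1.sub_const c).pow_const 2).ennreal_ofReal
  let r : (ι → Bool) → ι → ℝ≥0∞ := fun θ i => ∫⁻ ω, loss i (if θ i then γ else 0) (Y θ ω) ∂P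
  -- Bessel's inequality: the total loss dominates the sum of the losses in the coordinates along
  -- `e`.
  have hrisk : ∀ θ, ∑ i, r θ i ≤ ∫⁻ ω, ‖T (Y θ ω) - hypercubeVertex e γ θ‖ₑ ^ 2 ∂P := by
    intro θ
    simp only [r]
    rw [← lintegral_finsetSum (f := fun i ω => loss i (if θ i then γ else 0) (Y θ ω)) _
      fun i _ => (hloss i _).comp (hY θ)]
    refine lintegral_mono fun ω => ?_
    rw [← ofReal_norm, ← ENNReal.ofReal_pow (norm_nonneg _),
      ← ENNReal.ofReal_sum_of_nonneg fun i _ => sq_nonneg _]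
    refine ENNReal.ofReal_le_ofReal ?_
    refine le_trans (le_of_eq (Finset.sum_congr rfl fun i _ => ?_))
      (he.sum_inner_products_le (x := T (Y θ ω) - hypercubeVertex e γ θ) (s := Finset.univ))
    rw [inner_sub_right, inner_hypercubeVertex he, Real.norm_eq_abs, sq_abs]
  -- Both coordinate risks are bounded below by integrals over the common part `Λ`, where the same
  -- value of `T` has to serve both vertices.
  have hpair : ∀ θ i, ENNReal.ofReal (overlap * γ ^ 2 / 2) ≤ r θ i + r (flipBit i θ) i := by
    intro θ i
    obtain ⟨Λ, h1, h2, hΛ⟩ := hz.exists_common_minorant hε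
      (fun v => inner ℝ (hypercubeVertex H γ θ) v)
      (fun v => inner ℝ (hypercubeVertex H γ (flipBit i θ)) v)
      ((if θ i then -γ else γ) • H i)
      (fun v => by rw [hypercubeVertex_flipBit, inner_add_left])
      (by have := hγ i; rw [norm_smul] at this ⊢; split_ifs <;> simpa using this)
    have hle : ∀ θ' : ι → Bool, Λ ≤ P.map (Y θ') →
        ∫⁻ y, loss i (if θ' i then γ else 0) y ∂Λ ≤ r θ' i := fun θ' h => by
      simp only [r]
      rw [← lintegral_map (hloss i _) (hY θ')]
      exact lintegral_mono' h le_rfl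
    refine le_trans ?_ (add_le_add (hle θ h1) (hle (flipBit i θ) h2))
    rw [← lintegral_add_left (hloss i _), flipBit_apply_self]
    calc ENNReal.ofReal (overlap * γ ^ 2 / 2)
        = ENNReal.ofReal (γ ^ 2 / 2) * ENNReal.ofReal overlap := by
          rw [← ENNReal.ofReal_mul (by positivity)]
          congr 1
          ring
      _ ≤ ENNReal.ofReal (γ ^ 2 / 2) * Λ Set.univ := by gcongr
      _ = ∫⁻ _, ENNReal.ofReal (γ ^ 2 / 2) ∂Λ := by rw [lintegral_const]
      _ ≤ _ := lintegral_mono fun y => by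
          simp only [loss]
          rw [← ENNReal.ofReal_add (sq_nonneg _) (sq_nonneg _)]
          refine ENNReal.ofReal_le_ofReal ?_
          -- With `x` the estimated coordinate, `x² + (x - γ)² - γ²/2 = (2x - γ)²/2`.
          cases θ i <;> simp <;> nlinarith [sq_nonneg (2 * inner ℝ (e i) (T y) - γ)]
  -- Flipping a bit permutes the vertices, so summing the pair bounds counts every vertex twice.
  have hcoord : ∀ i, (Fintype.card (ι → Bool)) * ENNReal.ofReal (overlap * γ ^ 2 / 4)
      ≤ ∑ θ, r θ i := by
    intro i
    have h1 : ∑ θ, r (flipBit i θ) i = ∑ θ, r θ i :=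
      Equiv.sum_comp (flipBit i) fun θ => r θ i
    have h2 : ∑ _θ : ι → Bool, ENNReal.ofReal (overlap * γ ^ 2 / 2) ≤ 2 * ∑ θ, r θ i := by
      refine le_trans (Finset.sum_le_sum fun θ _ => hpair θ i) ?_
      rw [Finset.sum_add_distrib, h1, two_mul]
    rw [Finset.sum_const, Finset.card_univ, nsmul_eq_mul, show overlap * γ ^ 2 / 2
      = 2 * (overlap * γ ^ 2 / 4) by ring, ENNReal.ofReal_mul zero_le_two, ENNReal.ofReal_ofNat,
      mul_left_comm] at h2
    exact (ENNReal.mul_le_mul_iff_right two_ne_zero ENNReal.ofNat_ne_top).1 h2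
  have hsum : ∑ _θ : ι → Bool, ENNReal.ofReal (overlap / 4 * Fintype.card ι * γ ^ 2)
      ≤ ∑ θ, ∫⁻ ω, ‖T (Y θ ω) - hypercubeVertex e γ θ‖ₑ ^ 2 ∂P := by
    refine le_trans ?_ (Finset.sum_le_sum fun θ _ => hrisk θ)
    rw [Finset.sum_comm]
    refine le_trans (le_of_eq ?_) (Finset.sum_le_sum fun i _ => hcoord i)
    rw [Finset.sum_const, Finset.sum_const, Finset.card_univ, Finset.card_univ, nsmul_eq_mul,
      nsmul_eq_mul, mul_left_comm, show overlap / 4 * Fintype.card ι * γ ^ 2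
        = Fintype.card ι * (overlap * γ ^ 2 / 4) by ring,
      ENNReal.ofReal_mul (Nat.cast_nonneg _), ENNReal.ofReal_natCast]
  obtain ⟨θ, -, hθ⟩ := Finset.exists_max_image Finset.univ
    (fun θ => ∫⁻ ω, ‖T (Y θ ω) - hypercubeVertex e γ θ‖ₑ ^ 2 ∂P) Finset.univ_nonempty
  refine ⟨θ, ?_⟩
  have hmax := hsum.trans (Finset.sum_le_sum hθ)
  rw [Finset.sum_const, Finset.sum_const, nsmul_eq_mul, nsmul_eq_mul] at hmax
  exact (ENNReal.mul_le_mul_iff_right (by simp) (ENNReal.natCast_ne_top _)).1 hmax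

end Hypercube

/-! ### Fourier coefficients on the unit interval -/

/-- The exponential `e_m(x) = exp (2πimx)`. -/
def expMode (m : ℤ) (x : ℝ) : ℂ := Complex.exp (2 * Real.pi * Complex.I * m * x)

lemma continuous_expMode (m : ℤ) : Continuous (expMode m) := by
  unfold expMode
  fun_prop

lemma norm_expMode (m : ℤ) (x : ℝ) : ‖expMode m x‖ = 1 := by
  rw [expMode, show (2 * Real.pi * Complex.I * m * x : ℂ)
    = ((2 * Real.pi * m * x : ℝ) : ℂ) * Complex.I by push_cast; ring, Complex.norm_exp_ofReal_mul_I]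

lemma expMode_add (m n : ℤ) (x : ℝ) : expMode (m + n) x = expMode m x * expMode n x := by
  rw [expMode, expMode, expMode, ← Complex.exp_add]
  congr 1
  push_cast
  ring

lemma expMode_sub_arg (m : ℤ) (x y : ℝ) : expMode m (x - y) = expMode m x * expMode (-m) y := by
  rw [expMode, expMode, expMode, ← Complex.exp_add]
  congr 1
  push_cast
  ring

lemma expMode_add_int (m : ℤ) (x : ℝ) (l : ℤ) : expMode m (x + l) = expMode m x := by
  rw [expMode, expMode, show (2 * Real.pi * Complex.I * m * ((x + l : ℝ) : ℂ) : ℂ)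
    = 2 * Real.pi * Complex.I * m * x + ((m * l : ℤ) : ℂ) * (2 * Real.pi * Complex.I) by
      push_cast; ring, Complex.exp_add, Complex.exp_int_mul_two_pi_mul_I, mul_one]

lemma integral_unitMeasure {E : Type*} [NormedAddCommGroup E] [NormedSpace ℝ E] (f : ℝ → E) :
    ∫ x, f x ∂unitMeasure = ∫ x in (0 : ℝ)..1, f x := by
  rw [intervalIntegral.integral_of_le zero_le_one, ← integral_Icc_eq_integral_Ioc]

lemma integral_expMode (m : ℤ) : ∫ x, expMode m x ∂unitMeasure = if m = 0 then 1 else 0 := by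
  rw [integral_unitMeasure]
  split_ifs with h
  · simp [expMode, h]
  · have hc : (2 * Real.pi * Complex.I * m : ℂ) ≠ 0 := by
      simp [Real.pi_ne_zero, h]
    simp only [expMode]
    rw [integral_exp_mul_complex hc]
    have h1 := Complex.exp_int_mul_two_pi_mul_I m
    rw [show (2 * Real.pi * Complex.I * m : ℂ) * ((1 : ℝ) : ℂ) = m * (2 * Real.pi * Complex.I) by
      push_cast; ring, h1]
    simp

/-- The Fourier coefficient `∫_0^1 e_{-m}(x) f(x) dx`. -/
def unitCoeff (f : ℝ → ℂ) (m : ℤ) : ℂ := ∫ x, expMode (-m) x * f x ∂unitMeasure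

lemma unitCoeff_eq_fourierCoeffOn (f : ℝ → ℂ) (m : ℤ) :
    unitCoeff f m = fourierCoeffOn (zero_lt_one' ℝ) f m := by
  rw [fourierCoeffOn_eq_integral, unitCoeff, integral_unitMeasure]
  simp only [sub_zero, div_one, one_smul, fourier_coe_apply, expMode, smul_eq_mul,
    Complex.ofReal_one]

/-- Parseval's identity on the unit interval. -/
lemma hasSum_sq_unitCoeff {f : ℝ → ℂ} (hf : MemLp f 2 unitMeasure) :
    HasSum (fun m => ‖unitCoeff f m‖ ^ 2) (∫ x, ‖f x‖ ^ 2 ∂unitMeasure) := by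
  have h := hasSum_sq_fourierCoeffOn (zero_lt_one' ℝ) (f := f)
    (by rwa [Measure.restrict_congr_set Ioc_ae_eq_Icc])
  simpa [unitCoeff_eq_fourierCoeffOn, integral_unitMeasure] using h

/-- The trigonometric polynomial `∑_{m ∈ S} a_m e_m`. -/
def trigPoly (S : Finset ℤ) (a : ℤ → ℂ) (x : ℝ) : ℂ := ∑ m ∈ S, a m * expMode m x

lemma continuous_trigPoly (S : Finset ℤ) (a : ℤ → ℂ) : Continuous (trigPoly S a) :=
  continuous_finsetSum _ fun m _ => continuous_const.mul (continuous_expMode m)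

lemma memLp_trigPoly (S : Finset ℤ) (a : ℤ → ℂ) : MemLp (trigPoly S a) 2 unitMeasure := by
  refine MemLp.of_bound (continuous_trigPoly S a).aestronglyMeasurable (∑ m ∈ S, ‖a m‖)
    (ae_of_all _ fun x => ?_)
  refine (norm_sum_le _ _).trans (Finset.sum_le_sum fun m _ => ?_)
  rw [norm_mul, norm_expMode, mul_one]

lemma integrable_unitMeasure_of_continuous {f : ℝ → ℂ} (hf : Continuous f) :
    Integrable f unitMeasure :=
  hf.continuousOn.integrableOn_compact isCompact_Icc

lemma unitCoeff_trigPoly (S : Finset ℤ) (a : ℤ → ℂ) (m : ℤ) :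
    unitCoeff (trigPoly S a) m = if m ∈ S then a m else 0 := by
  have h1 : ∀ x, expMode (-m) x * trigPoly S a x = ∑ n ∈ S, a n * expMode (-m + n) x := fun x => by
    rw [trigPoly, Finset.mul_sum]
    refine Finset.sum_congr rfl fun n _ => ?_
    rw [expMode_add]
    ring
  rw [unitCoeff]
  simp_rw [h1]
  rw [integral_finsetSum _ fun n _ =>
    (integrable_unitMeasure_of_continuous (continuous_expMode _)).const_mul _]
  simp_rw [integral_const_mul, integral_expMode, neg_add_eq_zero, mul_ite, mul_one, mul_zero]
  rw [Finset.sum_ite_eq]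

lemma integral_sq_trigPoly (S : Finset ℤ) (a : ℤ → ℂ) :
    ∫ x, ‖trigPoly S a x‖ ^ 2 ∂unitMeasure = ∑ m ∈ S, ‖a m‖ ^ 2 := by
  have h := hasSum_sq_unitCoeff (memLp_trigPoly S a)
  simp_rw [unitCoeff_trigPoly] at h
  refine h.unique ?_
  have h1 : ∑ m ∈ S, ‖a m‖ ^ 2 = ∑ m ∈ S, ‖if m ∈ S then a m else 0‖ ^ 2 :=
    Finset.sum_congr rfl fun m hm => by rw [if_pos hm]
  rw [h1]
  exact hasSum_sum_of_ne_finset_zero fun m hm => by simp [hm]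

/-- A square integrable function with finitely many nonzero Fourier coefficients is almost
everywhere a trigonometric polynomial. -/
lemma ae_eq_trigPoly {f : ℝ → ℂ} (hf : MemLp f 2 unitMeasure) (S : Finset ℤ)
    (hS : ∀ m ∉ S, unitCoeff f m = 0) : f =ᵐ[unitMeasure] trigPoly S (unitCoeff f) := by
  have hD := hf.sub (memLp_trigPoly S (unitCoeff f))
  have hint : ∀ (h : ℝ → ℂ) (m : ℤ), MemLp h 2 unitMeasure →
      Integrable (fun x => expMode (-m) x * h x) unitMeasure := fun h m hh => by
    refine (hh.integrable one_le_two).bdd_mul (c := 1)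
      (continuous_expMode _).aestronglyMeasurable (ae_of_all _ fun x => (norm_expMode _ _).le)
  -- The difference has no nonzero Fourier coefficient, so by Parseval its `L²` norm vanishes.
  have h0 : ∀ m, unitCoeff (f - trigPoly S (unitCoeff f)) m = 0 := fun m => by
    have : unitCoeff (f - trigPoly S (unitCoeff f)) m
        = unitCoeff f m - unitCoeff (trigPoly S (unitCoeff f)) m := by
      simp only [unitCoeff, Pi.sub_apply, mul_sub]
      exact integral_sub (hint _ m hf) (hint _ m (memLp_trigPoly _ _))
    rw [this, unitCoeff_trigPoly]
    split_ifs with h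
    · simp
    · simp [hS m h]
  have hsum := hasSum_sq_unitCoeff hD
  simp_rw [h0] at hsum
  have hzero : ∫ x, ‖(f - trigPoly S (unitCoeff f)) x‖ ^ 2 ∂unitMeasure = 0 := by
    refine hsum.unique ?_
    simp
  rw [integral_eq_zero_iff_of_nonneg (fun x => sq_nonneg _) (hD.integrable_norm_pow two_ne_zero)]
    at hzero
  filter_upwards [hzero] with x hx
  simpa [sub_eq_zero] using hx

/-- Unfolding of the integral of a periodization. -/
lemma integral_tsum_translates {F : ℝ → ℂ} (hF : Integrable F) :
    ∫ x, ∑' l : ℤ, F (x + l) ∂unitMeasure = ∫ x, F x := by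
  have h1 := hF.hasSum_intervalIntegral_comp_add_int
  have h2 := hF.norm.hasSum_intervalIntegral_comp_add_int
  have h3 := hasSum_integral_of_summable_integral_norm (μ := unitMeasure)
    (F := fun (l : ℤ) x => F (x + l)) (fun l => (hF.comp_add_right (l : ℝ)).restrict)
    (by simp_rw [integral_unitMeasure]; exact h2.summable)
  simp_rw [integral_unitMeasure (fun x : ℝ => F (x + ((_ : ℤ) : ℝ)))] at h3
  exact h3.unique h1

/-- The Fourier coefficients of a periodized function vanish where its Fourier transform does. -/
lemma unitCoeff_periodized_eq_zero {w : ℝ → ℝ} (hw : Integrable w) (j k : ℕ) (m : ℤ)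
    (hm : 𝓕 (fun x : ℝ => (w x : ℂ)) (m / 2 ^ j) = 0) :
    unitCoeff (fun x => (periodized w j k x : ℂ)) m = 0 := by
  have h2j : (0 : ℝ) < 2 ^ j := by positivity
  -- The integrand after the substitution `y = 2^j x - k`. Its integral is a phase times the Fourier
  -- transform of `w` at `m / 2^j`; integer translates leave the exponential unchanged, which allows
  -- the unfolding.
  let G : ℝ → ℂ := fun y => expMode (-m) ((y + k) / 2 ^ j) * w y
  have hG : Integrable G :=
    hw.ofReal.bdd_mul (c := 1)
      ((continuous_expMode _).comp (by fun_prop)).aestronglyMeasurable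
      (ae_of_all _ fun x => (norm_expMode _ _).le)
  let F : ℝ → ℂ := fun x => ((2 : ℝ) ^ ((j : ℝ) / 2) : ℝ) * G (2 ^ j * x - k)
  have hF : Integrable F := by
    refine Integrable.const_mul ?_ _
    exact (hG.comp_sub_right (k : ℝ)).comp_mul_left' h2j.ne'
  have hfold : unitCoeff (fun x => (periodized w j k x : ℂ)) m = ∫ x, F x := by
    rw [← integral_tsum_translates hF, unitCoeff]
    congr 1
    funext x
    rw [periodized, Complex.ofReal_tsum, ← tsum_mul_left]
    refine tsum_congr fun l => ?_
    simp only [F, G]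
    rw [show (2 ^ j * (x + l) - k + k : ℝ) / 2 ^ j = x + l by field_simp; ring, expMode_add_int]
    push_cast
    ring
  have hGint : ∫ y, G y = 0 := by
    have h1 : ∀ y, G y = expMode (-m) (k / 2 ^ j) *
        (Complex.exp (↑(-2 * Real.pi * y * (m / 2 ^ j)) * Complex.I) • (w y : ℂ)) := fun y => by
      simp only [G, expMode, smul_eq_mul]
      rw [← mul_assoc, ← Complex.exp_add]
      congr 2
      push_cast
      ring
    simp_rw [h1]
    rw [integral_const_mul, ← Real.fourier_real_eq_integral_exp_smul, hm, mul_zero]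
  rw [hfold]
  simp only [F]
  rw [integral_const_mul, Measure.integral_comp_mul_left (fun x => G (x - k)),
    integral_sub_right_eq_self G, hGint, smul_zero, mul_zero]

/-! ### Convolution with trigonometric polynomials -/

/-- The convolution `∫_0^1 g(u, t - x) F(x) dx`. -/
def unitConv (g : ℝ → ℝ → ℝ) (F : ℝ → ℝ) (u t : ℝ) : ℝ := ∫ x, g u (t - x) * F x ∂unitMeasure

lemma stronglyMeasurable_unitConv {g : ℝ → ℝ → ℝ} (hg : Measurable (Function.uncurry g))
    {F : ℝ → ℝ} (hF : Continuous F) :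
    StronglyMeasurable fun w : ℝ × ℝ => unitConv g F w.1 w.2 := by
  refine StronglyMeasurable.integral_prod_right' (f := fun (y : (ℝ × ℝ) × ℝ) =>
    g y.1.1 (y.1.2 - y.2) * F y.2) ?_
  refine Measurable.stronglyMeasurable (Measurable.mul ?_ (hF.measurable.comp measurable_snd))
  exact hg.comp ((measurable_fst.comp measurable_fst).prodMk
    ((measurable_snd.comp measurable_fst).sub measurable_snd))

namespace IsConvolutionKernel

variable {ν C₁ C₂ : ℝ} {g : ℝ → ℝ → ℝ}

lemma intervalIntegrable (hg : IsConvolutionKernel ν C₁ C₂ g) {u : ℝ} (hu : u ∈ Set.Icc (0 : ℝ) 1)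
    (a b : ℝ) : IntervalIntegrable (g u) volume a b := by
  refine (hg.periodic u).intervalIntegrable₀ one_ne_zero ?_ a b
  rw [intervalIntegrable_iff_integrableOn_Icc_of_le zero_le_one]
  exact hg.integrable u hu

lemma integrable_translate (hg : IsConvolutionKernel ν C₁ C₂ g) {u : ℝ}
    (hu : u ∈ Set.Icc (0 : ℝ) 1) (t : ℝ) : Integrable (fun x => g u (t - x)) unitMeasure := by
  have h := (hg.intervalIntegrable hu (t - 0) (t - 1)).comp_sub_left t
  simp only [sub_sub_cancel] at h
  rw [intervalIntegrable_iff_integrableOn_Icc_of_le zero_le_one] at h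
  exact h

lemma integrable_translate_mul (hg : IsConvolutionKernel ν C₁ C₂ g) {u : ℝ}
    (hu : u ∈ Set.Icc (0 : ℝ) 1) (t : ℝ) {F : ℝ → ℝ} (hF : Continuous F) :
    Integrable (fun x => g u (t - x) * F x) unitMeasure :=
  IntegrableOn.mul_continuousOn (hg.integrable_translate hu t) hF.continuousOn isCompact_Icc

/-- Substituting `s = t - x` and moving the period `[t - 1, t]` to `[0,1]`. The index is `-m`
because `kernelCoeff` integrates against `e_m` rather than its conjugate. -/
lemma integral_translate_mul_expMode (hg : IsConvolutionKernel ν C₁ C₂ g) (u t : ℝ) (m : ℤ) :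
    ∫ x, (g u (t - x) : ℂ) * expMode m x ∂unitMeasure = kernelCoeff g (-m) u * expMode m t := by
  have hper : Function.Periodic (fun s => (g u s : ℂ) * expMode (-m) s) 1 := fun s => by
    have h1 := expMode_add_int (-m) s 1
    rw [Int.cast_one] at h1
    simp only [hg.periodic u s, h1]
  have h1 : ∀ x : ℝ, (g u (t - x) : ℂ) * expMode m x
      = (fun s => (g u s : ℂ) * expMode (-m) s * expMode m t) (t - x) := fun x => by
    simp only
    rw [expMode_sub_arg, neg_neg, show (g u (t - x) : ℂ) * (expMode (-m) t * expMode m x)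
      * expMode m t = (g u (t - x) : ℂ) * expMode m x * (expMode (-m) t * expMode m t) by ring,
      ← expMode_add]
    simp [expMode]
  simp_rw [h1]
  rw [integral_unitMeasure, intervalIntegral.integral_comp_sub_left
    (fun s => (g u s : ℂ) * expMode (-m) s * expMode m t) t, intervalIntegral.integral_mul_const]
  congr 1
  have h2 := hper.intervalIntegral_add_eq (t - 1) 0
  rw [show t - 1 + 1 = t - 0 by ring, zero_add] at h2
  rw [h2, kernelCoeff, integral_unitMeasure]
  congr 1
  funext s
  rw [Complex.conj_ofReal, expMode, mul_comm]

lemma unitConv_eq_trigPoly (hg : IsConvolutionKernel ν C₁ C₂ g) {u : ℝ}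
    (hu : u ∈ Set.Icc (0 : ℝ) 1) {F : ℝ → ℝ} {S : Finset ℤ} {a : ℤ → ℂ}
    (hFS : (fun x => (F x : ℂ)) =ᵐ[unitMeasure] trigPoly S a) (t : ℝ) :
    (unitConv g F u t : ℂ) = trigPoly S (fun m => a m * kernelCoeff g (-m) u) t := by
  have h1 : (fun x => ((g u (t - x) * F x : ℝ) : ℂ)) =ᵐ[unitMeasure]
      fun x => ∑ m ∈ S, a m * ((g u (t - x) : ℂ) * expMode m x) := by
    filter_upwards [hFS] with x hx
    push_cast
    rw [hx, trigPoly, Finset.mul_sum]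
    exact Finset.sum_congr rfl fun m _ => by ring
  rw [unitConv, ← integral_complex_ofReal, integral_congr_ae h1, integral_finsetSum]
  · simp_rw [integral_const_mul, hg.integral_translate_mul_expMode, trigPoly, mul_assoc]
  · intro m _
    refine Integrable.const_mul ?_ _
    exact IntegrableOn.mul_continuousOn (hg.integrable_translate hu t).ofReal
      (continuous_expMode m).continuousOn isCompact_Icc

/-- Convolution at fixed `u` is diagonal in the exponentials, so Parseval on both sides reduces the
claim to a termwise comparison. -/
lemma lintegral_unitConv_sq_le (hg : IsConvolutionKernel ν C₁ C₂ g) {u : ℝ}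
    (hu : u ∈ Set.Icc (0 : ℝ) 1) {F : ℝ → ℝ} {S : Finset ℤ} {a : ℤ → ℂ}
    (hFS : (fun x => (F x : ℂ)) =ᵐ[unitMeasure] trigPoly S a) {K : ℝ}
    (hK : ∀ m ∈ S, ‖kernelCoeff g (-m) u‖ ^ 2 ≤ K) :
    ∫⁻ t, ‖unitConv g F u t‖ₑ ^ 2 ∂unitMeasure
      ≤ ENNReal.ofReal (K * ∫ x, F x ^ 2 ∂unitMeasure) := by
  have hF2 : ∫ x, F x ^ 2 ∂unitMeasure = ∑ m ∈ S, ‖a m‖ ^ 2 := by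
    rw [← integral_sq_trigPoly]
    refine integral_congr_ae ?_
    filter_upwards [hFS] with x hx
    rw [← hx, Complex.norm_real, Real.norm_eq_abs, sq_abs]
  set a' : ℤ → ℂ := fun m => a m * kernelCoeff g (-m) u
  have h1 : ∀ t, ‖unitConv g F u t‖ₑ ^ 2 = ENNReal.ofReal (‖trigPoly S a' t‖ ^ 2) := fun t => by
    rw [← hg.unitConv_eq_trigPoly hu hFS, Complex.norm_real, ENNReal.ofReal_pow (norm_nonneg _),
      ofReal_norm]
  simp_rw [h1]
  rw [← ofReal_integral_eq_lintegral_ofReal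
    ((memLp_trigPoly S a').integrable_norm_pow two_ne_zero) (ae_of_all _ fun _ => sq_nonneg _),
    integral_sq_trigPoly, hF2, Finset.mul_sum]
  refine ENNReal.ofReal_le_ofReal (Finset.sum_le_sum fun m hm => ?_)
  rw [norm_mul, mul_pow, mul_comm]
  exact mul_le_mul_of_nonneg_right (hK m hm) (sq_nonneg _)

/-- Convolution with the kernel contracts a tensor product whose `x`-factor has no low
frequencies. -/
lemma lintegral_tensor_unitConv_le (hg : IsConvolutionKernel ν C₁ C₂ g)
    {F : ℝ → ℝ} (hF : Continuous F) {S : Finset ℤ} {a : ℤ → ℂ}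
    (hFS : (fun x => (F x : ℂ)) =ᵐ[unitMeasure] trigPoly S a) {K : ℝ}
    (hK : ∀ m ∈ S, ∀ u ∈ Set.Icc (0 : ℝ) 1, ‖kernelCoeff g (-m) u‖ ^ 2 ≤ K)
    {G : ℝ → ℝ} (hG : MemLp G 2 unitMeasure) :
    AEStronglyMeasurable (fun w : ℝ × ℝ => G w.1 * unitConv g F w.1 w.2) squareMeasure ∧
    ∫⁻ w : ℝ × ℝ, ‖G w.1 * unitConv g F w.1 w.2‖ₑ ^ 2 ∂squareMeasure
      ≤ (∫⁻ u, ‖G u‖ₑ ^ 2 ∂unitMeasure) * ENNReal.ofReal (K * ∫ x, F x ^ 2 ∂unitMeasure) := by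
  have hmeas : AEStronglyMeasurable (fun w : ℝ × ℝ => G w.1 * unitConv g F w.1 w.2)
      squareMeasure :=
    hG.1.comp_fst.mul (stronglyMeasurable_unitConv hg.measurable hF).aestronglyMeasurable
  refine ⟨hmeas, ?_⟩
  rw [lintegral_prod _ (hmeas.enorm.pow_const 2), ← lintegral_mul_const'' _ (hG.1.enorm.pow_const 2)]
  refine lintegral_mono_ae ?_
  filter_upwards [ae_restrict_mem measurableSet_Icc] with u hu
  simp_rw [enorm_mul, mul_pow]
  rw [lintegral_const_mul]
  · gcongr
    exact hg.lintegral_unitConv_sq_le hu hFS fun m hm => hK m hm u hu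
  · exact ((stronglyMeasurable_unitConv hg.measurable hF).measurable.comp
      measurable_prodMk_left).enorm.pow_const 2

/-- An element of `L²(U)` is known only almost everywhere, but by Fubini almost every slice in `u`
is then known for almost every `x`, and its convolution is determined at every `t`. -/
lemma convolved_ae_eq (hg : IsConvolutionKernel ν C₁ C₂ g) {ι : Type*} [Fintype ι] (c : ι → ℝ)
    (F G : ι → ℝ → ℝ) (hF : ∀ i, Continuous (F i)) (f : L2U)
    (hf : f =ᵐ[squareMeasure] fun w => ∑ i, c i * (F i w.2 * G i w.1)) :
    convolved g f =ᵐ[squareMeasure] fun w => ∑ i, c i * (G i w.1 * unitConv g (F i) w.1 w.2) := by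
  have h1 : ∀ᵐ u ∂unitMeasure, ∀ t,
      convolved g f (u, t) = ∑ i, c i * (G i u * unitConv g (F i) u t) := by
    filter_upwards [Measure.ae_ae_of_ae_prod hf, ae_restrict_mem measurableSet_Icc] with u hu huI t
    have h2 : (fun x => g u (t - x) * f (u, x)) =ᵐ[unitMeasure]
        fun x => ∑ i, c i * G i u * (g u (t - x) * F i x) := by
      filter_upwards [hu] with x hx
      rw [hx, Finset.mul_sum]
      exact Finset.sum_congr rfl fun i _ => by ring
    rw [convolved, integral_congr_ae h2, integral_finsetSum _ fun i _ =>
      (hg.integrable_translate_mul huI t (hF i)).const_mul _]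
    simp_rw [integral_const_mul, unitConv, mul_assoc]
  filter_upwards [Measure.quasiMeasurePreserving_fst.ae h1] with w hw
  exact hw w.2

end IsConvolutionKernel

/-! ### Tensor products in `L²(U)` -/

lemma eLpNorm_two_sq {α : Type*} [MeasurableSpace α] (μ : Measure α) (f : α → ℝ) :
    eLpNorm f 2 μ ^ 2 = ∫⁻ x, ‖f x‖ₑ ^ 2 ∂μ := by
  have h := eLpNorm_nnreal_pow_eq_lintegral (μ := μ) (f := f) (p := 2) two_ne_zero
  simpa using h

lemma memLp_tensor {F G : ℝ → ℝ} (hF : MemLp F 2 unitMeasure) (hG : MemLp G 2 unitMeasure) :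
    MemLp (fun w : ℝ × ℝ => F w.2 * G w.1) 2 squareMeasure := by
  refine (memLp_two_iff_integrable_sq (hF.1.comp_snd.mul hG.1.comp_fst)).2 ?_
  refine (hG.integrable_sq.mul_prod hF.integrable_sq).congr (ae_of_all _ fun w => ?_)
  simp only [Pi.mul_apply]
  ring

/-- The tensor product `(u, x) ↦ a(x) b(u)`. -/
def tensor (a b : Lp ℝ 2 unitMeasure) : L2U := (memLp_tensor (Lp.memLp a) (Lp.memLp b)).toLp _

lemma coeFn_tensor (a b : Lp ℝ 2 unitMeasure) :
    tensor a b =ᵐ[squareMeasure] fun w => a w.2 * b w.1 := MemLp.coeFn_toLp _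

lemma inner_tensor (a b a' b' : Lp ℝ 2 unitMeasure) :
    inner ℝ (tensor a b) (tensor a' b') = inner ℝ a a' * inner ℝ b b' := by
  rw [L2.inner_def, L2.inner_def, L2.inner_def, mul_comm, ← integral_prod_mul]
  refine integral_congr_ae ?_
  filter_upwards [coeFn_tensor a b, coeFn_tensor a' b'] with w h1 h2
  rw [h1, h2]
  simp only [RCLike.inner_apply, conj_trivial]
  ring

lemma hypercubeVertex_ae_eq {ι : Type*} [Fintype ι] {e : ι → L2U} {E : ι → ℝ × ℝ → ℝ}
    (he : ∀ i, e i =ᵐ[squareMeasure] E i) (γ : ℝ) (θ : ι → Bool) :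
    hypercubeVertex e γ θ =ᵐ[squareMeasure] fun w => ∑ i, (if θ i then γ else 0) * E i w := by
  unfold hypercubeVertex
  refine (Lp.coeFn_finsetSum _ _).trans ?_
  have h : ∀ᵐ w ∂squareMeasure, ∀ i, ((if θ i then γ else 0) • e i : L2U) w
      = (if θ i then γ else 0) * E i w := by
    rw [ae_all_iff]
    intro i
    filter_upwards [Lp.coeFn_smul (if θ i then γ else 0) (e i), he i] with w h1 h2
    rw [h1, Pi.smul_apply, h2, smul_eq_mul]
  filter_upwards [h] with w hw
  rw [Finset.sum_apply]
  exact Finset.sum_congr rfl fun i _ => hw i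

/-- The mean of the observation at the vertices of a hypercube spanned by tensor products whose
`x`-factors are trigonometric polynomials. -/
lemma IsConvolutionKernel.exists_observation_eq {ν C₁ C₂ : ℝ} {g : ℝ → ℝ → ℝ}
    (hg : IsConvolutionKernel ν C₁ C₂ g) {ι : Type*} [Fintype ι] (a b : ι → Lp ℝ 2 unitMeasure)
    (ha : ∀ i, ‖a i‖ = 1) (hb : ∀ i, ‖b i‖ = 1) {K : ℝ} (hK0 : 0 ≤ K)
    (hS : ∀ i, ∃ (S : Finset ℤ) (c : ℤ → ℂ),
      (fun x => ((a i x : ℝ) : ℂ)) =ᵐ[unitMeasure] trigPoly S c ∧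
      ∀ m ∈ S, ∀ u ∈ Set.Icc (0 : ℝ) 1, ‖kernelCoeff g (-m) u‖ ^ 2 ≤ K) :
    ∃ H : ι → L2U, (∀ i, ‖H i‖ ^ 2 ≤ K) ∧
      ∀ {Ω : Type*} (γ : ℝ) (θ : ι → Bool) (ε : ℝ) (z : L2U → Ω → ℝ) (ω : Ω),
        observation g ε z (hypercubeVertex (fun i => tensor (a i) (b i)) γ θ) ω
          = fun v => inner ℝ (hypercubeVertex H γ θ) v + ε * z v ω := by
  choose S c hac hSK using hS
  -- A continuous representative of `a i`: its product with a translate of `g u` is integrable for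
  -- every `t` and every `u` in `[0,1]`, since `g u` is merely in `L¹`.
  let F : ι → ℝ → ℝ := fun i x => (trigPoly (S i) (c i) x).re
  have hFc : ∀ i, Continuous (F i) := fun i => Complex.continuous_re.comp (continuous_trigPoly _ _)
  have haF : ∀ i, a i =ᵐ[unitMeasure] F i := fun i => by
    filter_upwards [hac i] with x hx
    simp only [F, ← hx, Complex.ofReal_re]
  have hFS : ∀ i, (fun x => (F i x : ℂ)) =ᵐ[unitMeasure] trigPoly (S i) (c i) := fun i => by
    filter_upwards [hac i, haF i] with x h1 h2
    rw [← h1, h2]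
  have hF2 : ∀ i, ∫ x, F i x ^ 2 ∂unitMeasure = 1 := fun i => by
    have h1 : inner ℝ (a i) (a i) = (1 : ℝ) := by rw [real_inner_self_eq_norm_sq, ha]; simp
    rw [← h1, L2.inner_def]
    refine integral_congr_ae ?_
    filter_upwards [haF i] with x hx
    rw [hx]
    simp [sq]
  have hG2 : ∀ i, ∫⁻ u, ‖b i u‖ₑ ^ 2 ∂unitMeasure = 1 := fun i => by
    rw [← eLpNorm_two_sq, ← Lp.enorm_def, ← ofReal_norm, hb]
    simp
  have key := fun i => hg.lintegral_tensor_unitConv_le (hFc i) (hFS i) (hSK i) (Lp.memLp (b i))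
  simp_rw [hF2, hG2, mul_one, one_mul, ← eLpNorm_two_sq] at key
  -- Square integrability follows from the norm bound itself, whose right side is finite.
  have hmem : ∀ i, MemLp (fun w : ℝ × ℝ => b i w.1 * unitConv g (F i) w.1 w.2) 2 squareMeasure :=
    fun i => ⟨(key i).1, by
      by_contra h
      rw [not_lt, top_le_iff] at h
      have := (key i).2
      simp [h] at this⟩
  refine ⟨fun i => (hmem i).toLp _, fun i => ?_, ?_⟩
  · rw [← ENNReal.ofReal_le_ofReal_iff hK0, ENNReal.ofReal_pow (norm_nonneg _), ofReal_norm,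
      Lp.enorm_toLp]
    exact (key i).2
  · intro Ω γ θ ε z ω
    funext v
    rw [observation, L2.inner_def]
    congr 1
    have hf : hypercubeVertex (fun i => tensor (a i) (b i)) γ θ =ᵐ[squareMeasure]
        fun w => ∑ i, (if θ i then γ else 0) * (F i w.2 * b i w.1) := by
      refine hypercubeVertex_ae_eq (fun i => ?_) γ θ
      filter_upwards [coeFn_tensor (a i) (b i),
        Measure.quasiMeasurePreserving_snd.ae (haF i)] with w h1 h2
      rw [h1, h2]
    have hH := hypercubeVertex_ae_eq (fun i => (hmem i).coeFn_toLp) γ θ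
    refine integral_congr_ae ?_
    filter_upwards [hg.convolved_ae_eq _ F (fun i => b i) hFc _ hf, hH] with w h1 h2
    rw [h1, h2]
    simp [mul_comm]

/-! ### Wavelet coefficients -/

/-- The wavelets of level `m₀ + n` of a band-limited basis are trigonometric polynomials with
frequencies of order `2 ^ (m₀ + n)`. -/
lemma exists_trigPoly_wavelet {ψ : ℝ → ℝ} (hψ : Integrable ψ) {a b : ℝ}
    (hband : ∀ ξ : ℝ, |ξ| < a ∨ b < |ξ| → 𝓕 (fun x : ℝ => (ψ x : ℂ)) ξ = 0)
    (j k : ℕ) (h : Lp ℝ 2 unitMeasure) (hh : h =ᵐ[unitMeasure] periodized ψ j k) :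
    ∃ (S : Finset ℤ) (c : ℤ → ℂ), (fun x => ((h x : ℝ) : ℂ)) =ᵐ[unitMeasure] trigPoly S c ∧
      ∀ m ∈ S, a * 2 ^ j ≤ |(m : ℝ)| := by
  have h2j : (0 : ℝ) < 2 ^ j := by positivity
  -- The upper cutoff serves only to make the set finite; the lower one is what the decay of the
  -- kernel needs.
  let S : Finset ℤ := {m ∈ Finset.Icc (-⌈b * 2 ^ j⌉) ⌈b * 2 ^ j⌉ | a * 2 ^ j ≤ |(m : ℝ)|}
  have hmem : MemLp (fun x => ((h x : ℝ) : ℂ)) 2 unitMeasure := (Lp.memLp h).ofReal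
  have hcoeff : ∀ m, unitCoeff (fun x => ((h x : ℝ) : ℂ)) m
      = unitCoeff (fun x => (periodized ψ j k x : ℂ)) m := fun m => by
    refine integral_congr_ae ?_
    filter_upwards [hh] with x hx
    rw [hx]
  refine ⟨S, _, ae_eq_trigPoly hmem S fun m hm => ?_, fun m hm => (Finset.mem_filter.1 hm).2⟩
  rw [hcoeff]
  refine unitCoeff_periodized_eq_zero hψ j k m (hband _ ?_)
  rw [abs_div, abs_of_pos h2j, div_lt_iff₀ h2j, lt_div_iff₀ h2j]
  by_contra hcon
  push Not at hcon
  refine hm (Finset.mem_filter.2 ⟨?_, hcon.1⟩)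
  have hle : |(m : ℝ)| ≤ (⌈b * 2 ^ j⌉ : ℤ) := hcon.2.trans (Int.le_ceil _)
  rw [Finset.mem_Icc, ← abs_le]
  exact_mod_cast hle

lemma coeff_eq_inner {m₀ : ℕ} {φ ψ : ℝ → ℝ} {m₀' : ℕ} {χ η : ℝ → ℝ} (f : L2U) (n n' : ℕ)
    (k : Fin (blockCard m₀ n)) (k' : Fin (blockCard m₀' n')) (a b : Lp ℝ 2 unitMeasure)
    (ha : a =ᵐ[unitMeasure] waveletFun m₀ φ ψ n k)
    (hb : b =ᵐ[unitMeasure] waveletFun m₀' χ η n' k') :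
    coeff m₀ φ ψ m₀' χ η f n n' k k' = inner ℝ f (tensor a b) := by
  rw [L2.inner_def, coeff]
  refine integral_congr_ae ?_
  filter_upwards [coeFn_tensor a b, Measure.quasiMeasurePreserving_snd.ae ha,
    Measure.quasiMeasurePreserving_fst.ae hb] with w h1 h2 h3
  rw [h1, ← h2, ← h3]
  simp [mul_comm]

/-! ### Sequence norms -/

/-- Used for the outer norm: a vertex lives in one block of coefficients, so `q` plays no role. -/
lemma ellNorm_eq_of_support_subset {ι : Type*} {r : ℝ≥0∞} (hr : 1 ≤ r) {x : ι → ℝ≥0∞} (i : ι)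
    (hx : ∀ j ≠ i, x j = 0) : ellNorm r x = x i := by
  rw [ellNorm]
  split_ifs with h
  · refine le_antisymm (iSup_le fun j => ?_) (le_iSup x i)
    rcases eq_or_ne j i with rfl | hj
    · exact le_rfl
    · rw [hx j hj]
      exact zero_le
  · have hr0 : 0 < r.toReal := ENNReal.toReal_pos (one_pos.trans_le hr).ne' h
    rw [tsum_eq_single i fun j hj => by rw [hx j hj, ENNReal.zero_rpow_of_pos hr0],
      ← ENNReal.rpow_mul, mul_one_div_cancel hr0.ne', ENNReal.rpow_one]

lemma ellNorm_zero {ι : Type*} [Nonempty ι] {r : ℝ≥0∞} (hr : 1 ≤ r) :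
    ellNorm r (fun _ : ι => (0 : ℝ≥0∞)) = 0 :=
  ellNorm_eq_of_support_subset hr (Classical.arbitrary ι) fun _ _ => rfl

lemma ellNorm_le_of_card {ι : Type*} {r : ℝ≥0∞} (hr : 1 ≤ r) {x : ι → ℝ≥0∞} (s : Finset ι)
    {c : ℝ} (hc : 0 ≤ c) (hx : ∀ i ∉ s, x i = 0) (hxc : ∀ i, x i ≤ ENNReal.ofReal c) :
    ellNorm r x ≤ ENNReal.ofReal (c * (s.card : ℝ) ^ recip r) := by
  rw [ellNorm]
  split_ifs with h
  · simpa [recip, h] using hxc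
  · have hr0 : 0 < r.toReal := ENNReal.toReal_pos (one_pos.trans_le hr).ne' h
    have hrec : recip r = 1 / r.toReal := by rw [recip, ENNReal.toReal_inv, one_div]
    rw [tsum_eq_sum fun i hi => by rw [hx i hi, ENNReal.zero_rpow_of_pos hr0]]
    calc (∑ i ∈ s, x i ^ r.toReal) ^ (1 / r.toReal)
        ≤ (∑ _i ∈ s, ENNReal.ofReal c ^ r.toReal) ^ (1 / r.toReal) := by
          gcongr with i _
          exact hxc i
      _ = ENNReal.ofReal (c * (s.card : ℝ) ^ recip r) := by
          rw [Finset.sum_const, nsmul_eq_mul, ENNReal.mul_rpow_of_nonneg _ _ (by positivity),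
            ← ENNReal.rpow_mul, mul_one_div_cancel hr0.ne', ENNReal.rpow_one, mul_comm,
            ENNReal.ofReal_mul hc, hrec, ← ENNReal.ofReal_rpow_of_nonneg (Nat.cast_nonneg _)
              (by positivity), ENNReal.ofReal_natCast]

/-! ### Lower bound within one block of coefficients -/

lemma blockCard_pos (m₀ n : ℕ) : 0 < blockCard m₀ n := by
  cases n <;> simp [blockCard]

section Block

variable {m₀ : ℕ} {φ ψ : ℝ → ℝ} {m₀' : ℕ} {χ η : ℝ → ℝ}
  {b : HilbertBasis (Σ n : ℕ, Fin (blockCard m₀ n)) ℝ (Lp ℝ 2 unitMeasure)}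
  {b' : HilbertBasis (Σ n : ℕ, Fin (blockCard m₀' n)) ℝ (Lp ℝ 2 unitMeasure)}
  {ι : Type*} {n n' : ℕ}

lemma inner_tensor_basis (s t : Σ n : ℕ, Fin (blockCard m₀ n))
    (s' t' : Σ n : ℕ, Fin (blockCard m₀' n)) :
    inner ℝ (tensor (b s) (b' s')) (tensor (b t) (b' t'))
      = if s = t ∧ s' = t' then (1 : ℝ) else 0 := by
  rw [inner_tensor, orthonormal_iff_ite.1 b.orthonormal, orthonormal_iff_ite.1 b'.orthonormal]
  by_cases h : s = t <;> by_cases h' : s' = t' <;> simp [h, h']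

lemma orthonormal_block (κ : ι ↪ Fin (blockCard m₀ n) × Fin (blockCard m₀' n')) :
    Orthonormal ℝ fun i => tensor (b ⟨n, (κ i).1⟩) (b' ⟨n', (κ i).2⟩) := by
  classical
  rw [orthonormal_iff_ite]
  intro i j
  rw [inner_tensor_basis]
  congr 1
  simp [Sigma.ext_iff, ← Prod.ext_iff]

variable [Fintype ι]

/-- The Besov norm of the vertices of a hypercube spanned by basis functions of one block. -/
lemma besovNorm_hypercubeVertex_le
    (hb : ∀ i, b i =ᵐ[unitMeasure] waveletFun m₀ φ ψ i.1 i.2)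
    (hb' : ∀ i, b' i =ᵐ[unitMeasure] waveletFun m₀' χ η i.1 i.2)
    (s₁ s₂ : ℝ) {p q : ℝ≥0∞} (hp : 1 ≤ p) (hq : 1 ≤ q)
    (κ : ι ↪ Fin (blockCard m₀ n) × Fin (blockCard m₀' n')) {γ : ℝ} (hγ : 0 ≤ γ)
    (θ : ι → Bool) :
    besovNorm m₀ φ ψ m₀' χ η s₁ s₂ p q
        (hypercubeVertex (fun i => tensor (b ⟨n, (κ i).1⟩) (b' ⟨n', (κ i).2⟩)) γ θ)
      ≤ ENNReal.ofReal ((2 : ℝ) ^ (blockLevel m₀ n * (s₁ + 1 / 2 - recip p)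
        + blockLevel m₀' n' * (s₂ + 1 / 2 - recip p)) *
          (γ * (Fintype.card ι : ℝ) ^ recip p)) := by
  classical
  set f := hypercubeVertex (fun i => tensor (b ⟨n, (κ i).1⟩) (b' ⟨n', (κ i).2⟩)) γ θ with hf
  have hcoeff : ∀ r r' (k : Fin (blockCard m₀ r)) (k' : Fin (blockCard m₀' r')),
      coeff m₀ φ ψ m₀' χ η f r r' k k' = ∑ i, (if θ i then γ else 0) *
        (if (⟨n, (κ i).1⟩ : Σ n : ℕ, Fin (blockCard m₀ n)) = ⟨r, k⟩ ∧
          (⟨n', (κ i).2⟩ : Σ n : ℕ, Fin (blockCard m₀' n)) = ⟨r', k'⟩ then (1 : ℝ) else 0) := by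
    intro r r' k k'
    rw [coeff_eq_inner f r r' k k' (b ⟨r, k⟩) (b' ⟨r', k'⟩) (hb ⟨r, k⟩) (hb' ⟨r', k'⟩), hf,
      hypercubeVertex, sum_inner]
    refine Finset.sum_congr rfl fun i _ => ?_
    rw [real_inner_smul_left, inner_tensor_basis]
  have hne : ∀ r r', Nonempty (Fin (blockCard m₀ r) × Fin (blockCard m₀' r')) := fun r r' =>
    ⟨⟨0, blockCard_pos _ _⟩, ⟨0, blockCard_pos _ _⟩⟩
  have hblock : ∀ k : Fin (blockCard m₀ n) × Fin (blockCard m₀' n'),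
      coeff m₀ φ ψ m₀' χ η f n n' k.1 k.2
        = ∑ i, if κ i = k then (if θ i then γ else 0) else 0 := by
    intro k
    rw [hcoeff]
    refine Finset.sum_congr rfl fun i _ => ?_
    simp [← Prod.ext_iff]
  rw [besovNorm, ellNorm_eq_of_support_subset hq (n, n')]
  · rw [ENNReal.ofReal_mul (by positivity)]
    gcongr
    have hcard : Fintype.card ι = (Finset.univ.map κ).card := by simp
    rw [hcard]
    refine ellNorm_le_of_card hp _ hγ (fun k hk => ?_) fun k => ENNReal.ofReal_le_ofReal ?_
    · rw [hblock, Finset.sum_eq_zero]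
      · simp
      · intro i _
        rw [if_neg]
        rintro rfl
        exact hk (by simp)
    · rw [hblock]
      by_cases hk : ∃ i, κ i = k
      · obtain ⟨i, rfl⟩ := hk
        simp only [EmbeddingLike.apply_eq_iff_eq, Finset.sum_ite_eq', Finset.mem_univ, if_true]
        split_ifs <;> simp [abs_of_nonneg hγ, hγ]
      · push Not at hk
        simp [hk, hγ]
  · rintro ⟨r, r'⟩ hr
    have hz : ∀ k : Fin (blockCard m₀ r) × Fin (blockCard m₀' r'),
        coeff m₀ φ ψ m₀' χ η f r r' k.1 k.2 = 0 := by
      intro k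
      rw [hcoeff]
      refine Finset.sum_eq_zero fun i _ => mul_eq_zero_of_right _ (if_neg ?_)
      rintro ⟨h1, h2⟩
      exact hr (Prod.ext (congrArg Sigma.fst h1).symm (congrArg Sigma.fst h2).symm)
    have := hne r r'
    simp only [hz, abs_zero, ENNReal.ofReal_zero, ellNorm_zero hp, mul_zero]

/-- The minimax risk dominates the one of the hypercube spanned by basis functions of one block. -/
lemma le_minimaxRisk_of_block (hψ : Integrable ψ) {a c : ℝ} (ha : 0 < a)
    (hband : ∀ ξ : ℝ, |ξ| < a ∨ c < |ξ| → 𝓕 (fun x : ℝ => (ψ x : ℂ)) ξ = 0)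
    (hb : ∀ i, b i =ᵐ[unitMeasure] waveletFun m₀ φ ψ i.1 i.2)
    (hb' : ∀ i, b' i =ᵐ[unitMeasure] waveletFun m₀' χ η i.1 i.2)
    {s₁ s₂ : ℝ} {p q : ℝ≥0∞} (hp : 1 ≤ p) (hq : 1 ≤ q)
    {ν C₁ C₂ : ℝ} (hν : 0 < ν) (hC₂ : 0 < C₂)
    {g : ℝ → ℝ → ℝ} (hg : IsConvolutionKernel ν C₁ C₂ g)
    (κ : ι ↪ Fin (blockCard m₀ (n + 1)) × Fin (blockCard m₀' n')) {γ ε A : ℝ} (hγ : 0 ≤ γ)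
    (hA : (2 : ℝ) ^ (blockLevel m₀ (n + 1 : ℕ) * (s₁ + 1 / 2 - recip p)
        + blockLevel m₀' n' * (s₂ + 1 / 2 - recip p)) *
          (γ * (Fintype.card ι : ℝ) ^ recip p) ≤ A)
    (hε : 0 < ε) (hγε : γ ^ 2 * (C₂ * (a * 2 ^ (m₀ + n)) ^ (-2 * ν)) ≤ ε ^ 2)
    {Ω : Type*} [MeasurableSpace Ω] {P : Measure Ω} {z : L2U → Ω → ℝ} (hz : IsWhiteNoise P z) :
    ENNReal.ofReal (overlap / 4 * Fintype.card ι * γ ^ 2) ≤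
      minimaxRisk P z g ε (besovBall m₀ φ ψ m₀' χ η s₁ s₂ p q A) := by
  have hfreq : (0 : ℝ) < a * 2 ^ (m₀ + n) := by positivity
  obtain ⟨H, hH, hobs⟩ := hg.exists_observation_eq
    (fun i => b ⟨n + 1, (κ i).1⟩) (fun i => b' ⟨n', (κ i).2⟩)
    (fun i => b.orthonormal.1 _) (fun i => b'.orthonormal.1 _)
    (K := C₂ * (a * 2 ^ (m₀ + n)) ^ (-2 * ν)) (by positivity) fun i => by
      obtain ⟨S, d, h1, h2⟩ := exists_trigPoly_wavelet hψ hband (m₀ + n) (κ i).1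
        (b ⟨n + 1, (κ i).1⟩) (hb ⟨n + 1, (κ i).1⟩)
      refine ⟨S, d, h1, fun m hm u hu => ?_⟩
      -- The block index `n + 1` selects genuine wavelets, whose band avoids the origin; at
      -- frequency `0` the kernel coefficient has no bound in terms of `C₂`.
      have hm0 : m ≠ 0 := by
        rintro rfl
        have := h2 0 hm
        simp only [Int.cast_zero, abs_zero] at this
        linarith
      refine (hg.upper (-m) (neg_ne_zero.2 hm0) u hu).trans ?_
      rw [Int.cast_neg, abs_neg]
      gcongr C₂ * ?_
      exact Real.rpow_le_rpow_of_nonpos hfreq (h2 m hm) (by linarith)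
  refine le_iInf₂ fun T hT => ?_
  obtain ⟨θ, hθ⟩ := hz.hypercube_lower_bound hε (orthonormal_block (b := b) (b' := b') κ) H
    (γ := γ) (fun i => by
      refine abs_le_of_sq_le_sq' ?_ hε.le |>.2
      rw [norm_smul, mul_pow, Real.norm_eq_abs, sq_abs]
      exact (mul_le_mul_of_nonneg_left (hH i) (sq_nonneg _)).trans hγε) T hT
  refine hθ.trans (le_iSup₂_of_le
    (hypercubeVertex (fun i => tensor (b ⟨n + 1, (κ i).1⟩) (b' ⟨n', (κ i).2⟩)) γ θ) ?_ ?_)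
  · exact (besovNorm_hypercubeVertex_le hb hb' s₁ s₂ hp hq κ hγ θ).trans
      (ENNReal.ofReal_le_ofReal hA)
  · exact (lintegral_congr fun ω => by rw [hobs γ θ ε z ω]).ge

end Block

/-! ### Choice of the resolution level -/

/-- Balancing of the smoothness constraint `D γ 2^{Jα} ≤ A` and the noise constraint
`γ² B 2^{-2Jβ} ≤ ε²` for a hypercube of dimension `2^{Jδ}` and side length `γ`. -/
lemma exists_level {α β δ D B c : ℝ} (hαβ : 0 < α + β) (hδ : δ ≤ 2 * α) (hD : 0 < D) (hB : 0 < B)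
    (hc : 0 < c) :
    ∃ C : ℝ, 0 < C ∧ ∀ A : ℝ, 0 < A → ∀ᶠ ε : ℝ in 𝓝[>] 0, 0 < ε ∧ ∃ (J : ℕ) (γ : ℝ), 0 ≤ γ ∧
      D * (γ * ((2 : ℝ) ^ J) ^ α) ≤ A ∧ γ ^ 2 * (B * ((2 : ℝ) ^ J) ^ (-2 * β)) ≤ ε ^ 2 ∧
      C * A ^ 2 * (ε ^ 2 / A ^ 2) ^ ((2 * α - δ) / (2 * (α + β)))
        ≤ c * ((2 : ℝ) ^ J) ^ δ * γ ^ 2 := by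
  set d := (2 * α - δ) / (2 * (α + β)) with hd
  have hsB : 0 < √B := Real.sqrt_pos.2 hB
  -- This is the value obtained below: `1/D²` from the choice of `γ`, the power of `2` from rounding
  -- to a dyadic level, the last factor from solving the noise constraint.
  refine ⟨c * (1 / D ^ 2) * 2 ^ (δ - 2 * α) * (√B / D) ^ (-2 * d), by positivity, fun A hA => ?_⟩
  have hA' : 0 < A * √B / D := by positivity
  filter_upwards [Ioo_mem_nhdsGT hA'] with ε hε
  obtain ⟨hε0, hε1⟩ := hε
  refine ⟨hε0, ?_⟩
  have hx0 : 0 < A * √B / (D * ε) := by positivity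
  have hx1 : 1 ≤ A * √B / (D * ε) := by
    rw [one_le_div (by positivity), mul_comm D]
    exact ((lt_div_iff₀ hD).1 hε1).le
  -- With `γ = (A/D) M^(-α)`, which saturates the smoothness constraint, the noise constraint reads
  -- `M^(α+β) ≥ A√B/(Dε)`; `L` is the real solution of the equality. Small `ε` makes `L ≥ 1`, so a
  -- power `M` of `2` satisfies `L < M ≤ 2L`.
  set L := (A * √B / (D * ε)) ^ (1 / (α + β)) with hL
  have hL0 : 0 < L := by positivity
  have hLpow : ∀ r, L ^ ((α + β) * r) = (A * √B / (D * ε)) ^ r := fun r => by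
    rw [hL, ← Real.rpow_mul hx0.le]
    congr 1
    field_simp
  obtain ⟨n, hn1, hn2⟩ := exists_nat_pow_near (Real.one_le_rpow hx1 (by positivity) : 1 ≤ L)
    (one_lt_two : (1 : ℝ) < 2)
  have hM0 : (0 : ℝ) < 2 ^ (n + 1) := by positivity
  have hM : (2 : ℝ) ^ (n + 1) ≤ 2 * L := by
    rw [pow_succ, mul_comm]
    linarith
  set M : ℝ := 2 ^ (n + 1) with hMdef
  refine ⟨n + 1, A / D * M ^ (-α), by positivity, ?_, ?_, ?_⟩
  · rw [mul_assoc, ← Real.rpow_add hM0, neg_add_cancel, Real.rpow_zero, mul_one,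
      mul_div_cancel₀ _ hD.ne']
  · have h1 : A * √B / (D * ε) ≤ M ^ (α + β) := by
      have h2 := hLpow 1
      rw [mul_one, Real.rpow_one] at h2
      rw [← h2]
      exact Real.rpow_le_rpow hL0.le hn2.le hαβ.le
    have h3 : A / D * √B * M ^ (-(α + β)) ≤ ε := by
      rw [Real.rpow_neg hM0.le, ← div_eq_mul_inv, div_le_iff₀ (by positivity)]
      rw [div_le_iff₀ (by positivity)] at h1
      rw [div_mul_eq_mul_div, div_le_iff₀ hD]
      linarith
    calc (A / D * M ^ (-α)) ^ 2 * (B * M ^ (-2 * β))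
        = (A / D * √B * M ^ (-(α + β))) ^ 2 := by
          rw [show -2 * β = -β + -β by ring, show -(α + β) = -α + -β by ring,
            Real.rpow_add hM0, Real.rpow_add hM0, mul_pow, mul_pow, mul_pow, Real.sq_sqrt hB.le]
          ring
      _ ≤ ε ^ 2 := by gcongr
  -- The gain `M^δ γ²` is proportional to `M^(δ - 2α)` with nonpositive exponent, so `M ≤ 2L` bounds
  -- it from below.
  · have h1 : (2 * L) ^ (δ - 2 * α) ≤ M ^ (δ - 2 * α) :=
      Real.rpow_le_rpow_of_nonpos hM0 hM (by linarith)
    have h2 : L ^ (δ - 2 * α) = (√B / D) ^ (-2 * d) * (ε ^ 2 / A ^ 2) ^ d := by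
      have h3 : δ - 2 * α = (α + β) * (-2 * d) := by
        rw [hd]
        field_simp
        ring
      rw [h3, hLpow, show A * √B / (D * ε) = √B / D * (ε / A)⁻¹ by field_simp,
        Real.mul_rpow (by positivity) (by positivity), Real.inv_rpow (by positivity),
        ← Real.rpow_neg (by positivity), ← div_pow, ← Real.rpow_natCast (ε / A),
        ← Real.rpow_mul (by positivity)]
      congr 2
      push_cast
      ring
    rw [Real.mul_rpow zero_le_two hL0.le, h2] at h1
    calc c * (1 / D ^ 2) * 2 ^ (δ - 2 * α) * (√B / D) ^ (-2 * d) * A ^ 2 * (ε ^ 2 / A ^ 2) ^ d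
        = c * (1 / D ^ 2) * A ^ 2 *
            (2 ^ (δ - 2 * α) * ((√B / D) ^ (-2 * d) * (ε ^ 2 / A ^ 2) ^ d)) := by ring
      _ ≤ c * (1 / D ^ 2) * A ^ 2 * M ^ (δ - 2 * α) := by gcongr
      _ = c * M ^ δ * (A / D * M ^ (-α)) ^ 2 := by
          rw [show δ - 2 * α = δ + (-α + -α) by ring, Real.rpow_add hM0, Real.rpow_add hM0]
          field_simp

/-! ### The three lower bounds -/

section Rates

variable {m₀ : ℕ} {φ ψ : ℝ → ℝ} {m₀' : ℕ} {χ η : ℝ → ℝ} {s₁ s₂ : ℝ} {p q : ℝ≥0∞} {ν C₂ : ℝ}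

/-- The statement that the minimax risk over Besov balls is at least of order
`A² (ε² / A²) ^ d`. -/
def RiskLowerBound.{u} (m₀ : ℕ) (φ ψ : ℝ → ℝ) (m₀' : ℕ) (χ η : ℝ → ℝ) (s₁ s₂ : ℝ) (p q : ℝ≥0∞)
    (ν C₁ C₂ d : ℝ) : Prop :=
  ∃ C : ℝ, 0 < C ∧
    ∀ g : ℝ → ℝ → ℝ, IsConvolutionKernel ν C₁ C₂ g →
    ∀ A : ℝ, 0 < A →
    ∀ᶠ ε : ℝ in 𝓝[>] 0,
    ∀ (Ω : Type u) [MeasurableSpace Ω] (P : Measure Ω) (z : L2U → Ω → ℝ), IsWhiteNoise P z →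
      ENNReal.ofReal (C * A ^ 2 * (ε ^ 2 / A ^ 2) ^ d) ≤
        minimaxRisk P z g ε (besovBall m₀ φ ψ m₀' χ η s₁ s₂ p q A)

/-- Many wavelets in the variable `u` at a fixed level in the variable `x`. -/
lemma riskLowerBound_dense_fst
    (hψ : IsBandLimitedWaveletBasis m₀ φ ψ) (hη : IsFinitelySupportedWaveletBasis m₀' χ η)
    (hp : 1 ≤ p) (hq : 1 ≤ q) (C₁ : ℝ) (hν : 0 < ν) (hC₂ : 0 < C₂)
    (hs : 0 ≤ s₂) :
    RiskLowerBound m₀ φ ψ m₀' χ η s₁ s₂ p q ν C₁ C₂ (2 * s₂ / (2 * s₂ + 1)) := by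
  obtain ⟨a, c, ha, -, -, hband⟩ := hψ.band
  obtain ⟨b, hb⟩ := hψ.basis
  obtain ⟨b', hb'⟩ := hη.basis
  -- In a full block the factor `card^(1/p)` cancels the `-1/p` in `s₂*`, whence `α = s₂ + 1/2`. The
  -- `x`-frequencies stay fixed, so refining in `u` brings no decay and `β = 0`.
  obtain ⟨C, hC, hlevel⟩ := exists_level (α := s₂ + 1 / 2) (β := 0) (δ := 1)
    (D := 2 ^ (blockLevel m₀ (0 + 1 : ℕ) * (s₁ + 1 / 2 - recip p) + m₀' * (s₂ + 1 / 2)))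
    (B := C₂ * (a * 2 ^ (m₀ + 0)) ^ (-2 * ν)) (c := overlap / 4) (by linarith) (by linarith)
    (by positivity) (by positivity) (by linarith [overlap_pos])
  refine ⟨C, hC, fun g hg A hA => ?_⟩
  filter_upwards [hlevel A hA] with ε ⟨hε, J, γ, hγ, hγA, hγε, hrate⟩ Ω _ P z hz
  have hM0 : (0 : ℝ) < 2 ^ J := by positivity
  have hcard : (blockCard m₀' (J + 1) : ℝ) = 2 ^ m₀' * 2 ^ J := by
    simp [blockCard, pow_add]
  refine le_trans (ENNReal.ofReal_le_ofReal ?_) (le_minimaxRisk_of_block (n := 0) (n' := J + 1)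
    hψ.integrable_wavelet ha hband hb hb' hp hq hν hC₂ hg
    ⟨fun k : Fin (blockCard m₀' (J + 1)) => (⟨0, blockCard_pos _ _⟩, k),
      fun k k' h => (Prod.ext_iff.1 h).2⟩ hγ ?_ hε ?_ hz)
  · rw [show 2 * s₂ / (2 * s₂ + 1) = (2 * (s₂ + 1 / 2) - 1) / (2 * (s₂ + 1 / 2 + 0)) by ring_nf]
    refine hrate.trans ?_
    have h1 : (1 : ℝ) ≤ 2 ^ m₀' := one_le_pow₀ one_le_two
    have h2 := overlap_pos
    rw [Real.rpow_one, Fintype.card_fin, hcard]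
    gcongr
    exact le_mul_of_one_le_left hM0.le h1
  · refine le_trans (le_of_eq ?_) hγA
    rw [Fintype.card_fin, hcard, show (2 : ℝ) ^ m₀' * 2 ^ J = 2 ^ ((m₀' : ℝ) + J) by
      rw [Real.rpow_add two_pos, Real.rpow_natCast, Real.rpow_natCast], ← Real.rpow_natCast 2 J,
      ← Real.rpow_mul zero_le_two, ← Real.rpow_mul zero_le_two, mul_left_comm,
      mul_left_comm _ γ, ← Real.rpow_add two_pos, ← Real.rpow_add two_pos]
    congr 2
    simp only [blockLevel]
    push_cast
    ring
  · simpa using hγε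

/-- Many wavelets in the variable `x` at a fixed level in the variable `u`. -/
lemma riskLowerBound_dense_snd
    (hψ : IsBandLimitedWaveletBasis m₀ φ ψ) (hη : IsFinitelySupportedWaveletBasis m₀' χ η)
    (hp : 1 ≤ p) (hq : 1 ≤ q) (C₁ : ℝ) (hν : 0 < ν) (hC₂ : 0 < C₂)
    (hs : 0 ≤ s₁) :
    RiskLowerBound m₀ φ ψ m₀' χ η s₁ s₂ p q ν C₁ C₂ (2 * s₁ / (2 * s₁ + 2 * ν + 1)) := by
  obtain ⟨a, c, ha, -, -, hband⟩ := hψ.band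
  obtain ⟨b, hb⟩ := hψ.basis
  obtain ⟨b', hb'⟩ := hη.basis
  -- Again `p` cancels over the full block, but now the frequencies grow with the level and the
  -- kernel contributes `β = ν`.
  obtain ⟨C, hC, hlevel⟩ := exists_level (α := s₁ + 1 / 2) (β := ν) (δ := 1)
    (D := 2 ^ (m₀ * (s₁ + 1 / 2) + blockLevel m₀' 0 * (s₂ + 1 / 2 - recip p)))
    (B := C₂ * (a * 2 ^ m₀) ^ (-2 * ν)) (c := overlap / 4) (by linarith) (by linarith)
    (by positivity) (by positivity) (by linarith [overlap_pos])
  refine ⟨C, hC, fun g hg A hA => ?_⟩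
  filter_upwards [hlevel A hA] with ε ⟨hε, J, γ, hγ, hγA, hγε, hrate⟩ Ω _ P z hz
  have hM0 : (0 : ℝ) < 2 ^ J := by positivity
  have hcard : (blockCard m₀ (J + 1) : ℝ) = 2 ^ m₀ * 2 ^ J := by
    simp [blockCard, pow_add]
  refine le_trans (ENNReal.ofReal_le_ofReal ?_) (le_minimaxRisk_of_block (n := J) (n' := 0)
    hψ.integrable_wavelet ha hband hb hb' hp hq hν hC₂ hg
    ⟨fun k : Fin (blockCard m₀ (J + 1)) => (k, ⟨0, blockCard_pos _ _⟩),
      fun k k' h => (Prod.ext_iff.1 h).1⟩ hγ ?_ hε ?_ hz)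
  · rw [show 2 * s₁ / (2 * s₁ + 2 * ν + 1) = (2 * (s₁ + 1 / 2) - 1) / (2 * (s₁ + 1 / 2 + ν)) by
      ring_nf]
    refine hrate.trans ?_
    have h1 : (1 : ℝ) ≤ 2 ^ m₀ := one_le_pow₀ one_le_two
    have h2 := overlap_pos
    rw [Real.rpow_one, Fintype.card_fin, hcard]
    gcongr
    exact le_mul_of_one_le_left hM0.le h1
  · refine le_trans (le_of_eq ?_) hγA
    rw [Fintype.card_fin, hcard, show (2 : ℝ) ^ m₀ * 2 ^ J = 2 ^ ((m₀ : ℝ) + J) by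
      rw [Real.rpow_add two_pos, Real.rpow_natCast, Real.rpow_natCast], ← Real.rpow_natCast 2 J,
      ← Real.rpow_mul zero_le_two, ← Real.rpow_mul zero_le_two, mul_left_comm,
      mul_left_comm _ γ, ← Real.rpow_add two_pos, ← Real.rpow_add two_pos]
    congr 2
    simp only [blockLevel]
    push_cast
    ring
  · rw [pow_add, ← mul_assoc a, Real.mul_rpow (by positivity) hM0.le, ← mul_assoc C₂]
    exact hγε

/-- A single wavelet coefficient. -/
lemma riskLowerBound_sparse
    (hψ : IsBandLimitedWaveletBasis m₀ φ ψ) (hη : IsFinitelySupportedWaveletBasis m₀' χ η)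
    (hp : 1 ≤ p) (hq : 1 ≤ q) (C₁ : ℝ) (hν : 0 < ν) (hC₂ : 0 < C₂)
    (hs : 0 ≤ s₁ + 1 / 2 - recip p) :
    RiskLowerBound m₀ φ ψ m₀' χ η s₁ s₂ p q ν C₁ C₂
      (2 * (s₁ + 1 / 2 - recip p) / (2 * (s₁ + 1 / 2 - recip p) + 2 * ν)) := by
  obtain ⟨a, c, ha, -, -, hband⟩ := hψ.band
  obtain ⟨b, hb⟩ := hψ.basis
  obtain ⟨b', hb'⟩ := hη.basis
  -- The dimension is one, so `δ = 0` and the `-1/p` in the smoothness index survives.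
  obtain ⟨C, hC, hlevel⟩ := exists_level (α := s₁ + 1 / 2 - recip p) (β := ν) (δ := 0)
    (D := 2 ^ (m₀ * (s₁ + 1 / 2 - recip p) + blockLevel m₀' 0 * (s₂ + 1 / 2 - recip p)))
    (B := C₂ * (a * 2 ^ m₀) ^ (-2 * ν)) (c := overlap / 4) (by linarith) (by linarith)
    (by positivity) (by positivity) (by linarith [overlap_pos])
  refine ⟨C, hC, fun g hg A hA => ?_⟩
  filter_upwards [hlevel A hA] with ε ⟨hε, J, γ, hγ, hγA, hγε, hrate⟩ Ω _ P z hz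
  have hM0 : (0 : ℝ) < 2 ^ J := by positivity
  refine le_trans (ENNReal.ofReal_le_ofReal ?_) (le_minimaxRisk_of_block (n := J) (n' := 0)
    hψ.integrable_wavelet ha hband hb hb' hp hq hν hC₂ hg
    ⟨fun _ : Unit => (⟨0, blockCard_pos _ _⟩, ⟨0, blockCard_pos _ _⟩),
      fun _ _ _ => rfl⟩ hγ ?_ hε ?_ hz)
  · rw [← mul_add]
    rw [Real.rpow_zero, sub_zero] at hrate
    simpa using hrate
  · refine le_trans (le_of_eq ?_) hγA
    rw [Fintype.card_unit, Nat.cast_one, Real.one_rpow, mul_one, ← Real.rpow_natCast 2 J,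
      ← Real.rpow_mul zero_le_two, mul_left_comm _ γ, ← Real.rpow_add two_pos, mul_comm γ]
    congr 2
    simp only [blockLevel]
    push_cast
    ring
  · rw [pow_add, ← mul_assoc a, Real.mul_rpow (by positivity) hM0.le, ← mul_assoc C₂]
    exact hγε

/-- The lower bound with the exponent of the theorem. -/
lemma riskLowerBound_rateExponent
    (hψ : IsBandLimitedWaveletBasis m₀ φ ψ) (hη : IsFinitelySupportedWaveletBasis m₀' χ η)
    (hp : 1 ≤ p) (hq : 1 ≤ q) (C₁ : ℝ) (hν : 0 < ν) (hC₂ : 0 < C₂)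
    (hs : max (recip p) (1 / 2) ≤ min s₁ s₂) :
    RiskLowerBound m₀ φ ψ m₀' χ η s₁ s₂ p q ν C₁ C₂ (rateExponent s₁ s₂ ν p) := by
  rw [max_le_iff, le_min_iff, le_min_iff] at hs
  obtain ⟨⟨hp1, -⟩, h1, h2⟩ := hs
  have hfst := riskLowerBound_dense_fst (s₁ := s₁) hψ hη hp hq C₁ hν hC₂ (s₂ := s₂) (by linarith)
  have hsnd := riskLowerBound_dense_snd (s₂ := s₂) hψ hη hp hq C₁ hν hC₂ (s₁ := s₁) (by linarith)
  simp only [rateExponent]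
  rcases le_total p 2 with hp2 | hp2
  · have hsparse := riskLowerBound_sparse (s₁ := s₁) (s₂ := s₂) hψ hη hp hq C₁ hν hC₂
      (by linarith)
    rw [min_eq_left hp2]
    rcases min_choice (min (2 * s₂ / (2 * s₂ + 1)) (2 * s₁ / (2 * s₁ + 2 * ν + 1)))
      (2 * (s₁ + 1 / 2 - recip p) / (2 * (s₁ + 1 / 2 - recip p) + 2 * ν)) with h | h <;> rw [h]
    · rcases min_choice (2 * s₂ / (2 * s₂ + 1)) (2 * s₁ / (2 * s₁ + 2 * ν + 1)) with h' | h' <;>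
        rw [h'] <;> assumption
    · exact hsparse
  · have hrec : s₁ + 1 / 2 - recip (min p 2) = s₁ := by
      rw [min_eq_right hp2, recip, ENNReal.toReal_inv]
      norm_num
    rw [hrec, min_eq_left]
    · rcases min_choice (2 * s₂ / (2 * s₂ + 1)) (2 * s₁ / (2 * s₁ + 2 * ν + 1)) with h' | h' <;>
        rw [h'] <;> assumption
    -- For `p ≥ 2` the sparse exponent has the numerator of the second one and a smaller
    -- denominator, so it never attains the minimum.
    · refine (min_le_right _ _).trans ?_
      exact div_le_div_of_nonneg_left (by linarith) (by linarith) (by linarith)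

end Rates

end FunctionalDeconvolution

end

open FunctionalDeconvolution in
theorem theorem1
    (m₀ : ℕ) (φ ψ : ℝ → ℝ) (hψ : IsBandLimitedWaveletBasis m₀ φ ψ)
    (m₀' : ℕ) (χ η : ℝ → ℝ) (hη : IsFinitelySupportedWaveletBasis m₀' χ η)
    (s₁ s₂ : ℝ) (p q : ℝ≥0∞) (hp : 1 ≤ p) (hq : 1 ≤ q)
    (hs : max (recip p) (1 / 2) ≤ min s₁ s₂)
    (ν C₁ C₂ : ℝ) (hν : 0 < ν) (hC₁ : 0 < C₁) (hC₂ : 0 < C₂) :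
    ∃ C : ℝ, 0 < C ∧
      ∀ g : ℝ → ℝ → ℝ, IsConvolutionKernel ν C₁ C₂ g →
      ∀ A : ℝ, 0 < A →
      ∀ᶠ ε : ℝ in 𝓝[>] 0,
      ∀ (Ω : Type*) [MeasurableSpace Ω] (P : Measure Ω) (z : L2U → Ω → ℝ), IsWhiteNoise P z →
        ENNReal.ofReal (C * A ^ 2 * (ε ^ 2 / A ^ 2) ^ rateExponent s₁ s₂ ν p) ≤
          minimaxRisk P z g ε (besovBall m₀ φ ψ m₀' χ η s₁ s₂ p q A) := by
  exact riskLowerBound_rateExponent hψ hη hp hq C₁ hν hC₂ hs
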